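/- Proposition (Variance Approximation for General Subgraph Counts), \label{prop:variance_approximation_general}. \textbf{Model.} For a symmetric matrix $Q\in[0,1]^{n\times n}$ with zero diagonal write $A\sim Q$ for the random simple graph on $n$ nodes whose adjacency entries $A_{ij}$, $i<j$, are independent Bernoulli variables with $\mathbb E[A_{ij}]=Q_{ij}$, and let $\mathrm{Var}_Q(T)$ be the variance of $T(A)$ for $A\sim Q$. In the Chung-Lu model, for each $n$, the observed network $A$ has the distribution $A\sim P=P^{(n)}$ with $P_{ij}=p\,\theta_i\theta_j$ for $i\neq j$ and $P_{ii}=0$, where $p=p(n)\to 0$, $np\to\infty$, $\theta=\theta^{(n)}\in\mathbb R^n$ satisfies $\sum_{i}\theta_i=n$, and $c_1<\theta_i<c_2$ for all $i$ with constants $0<c_1<c_2$ that do not depend on $n$. (Hence $P_{ij}\in[0,1]$ for all large $n$.) Let $\lambda_n=n^{-1}\sum_{i,j}P_{ij}$ be the average expected degree. The parameter $p$ is known, and $P$ is estimated by $$\widehat P_{ij}=p\,\widehat\theta_i\widehat\theta_j\ (i\ne j),\quad \widehat P_{ii}=0,\qquad \widehat\theta_i=\frac1{(n-1)p}\sum_{j\neq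 i}A_{ij}.$$ If an off-diagonal entry of $\widehat P$ (or of $P$, for small $n$) lies outside $[0,1]$, it is replaced by the nearest point of $[0,1]$ when it is used as an edge probability. \textbf{Counts.} Let $R$ be a fixed connected graph with $v\ge 3$ nodes (hence $e\ge 2$ edges). $T_R(A)$ is the number of (not necessarily induced) subgraphs of $A$ isomorphic to $R$. For a root $r\in R$ and a node $i$ of $A$, $T_R^{(i)}(A)$ is the number of subgraphs $G$ of $A$ for which some isomorphism $R\to G$ maps $r$ to $i$. \textbf{Claim.} For all large $n$, $\mathrm{Var}_P(T_R)>0$ and $\mathrm{Var}_P(T_R^{(i)})>0$ for every node $i$. As $n\to\infty$, for every root $r$ of $R$, uniformly over the nodes $i\in\{1,\dots,n\}$, $$\frac{\mathrm{Var}_{\widehat P}(T_R^{(i)})-\mathrm{Var}_P(T_R^{(i)})}{\mathrm{Var}_P(T_R^{(i)})}=O_{\mathbb P}\big(\lambda_n^{-1/2}\big)=O_{\mathbb P}\big((np)^{-1/2}\big),$$ and $$\frac{\mathrm{Var}_{\widehat P}(T_R)-\mathrm{Var}_P(T_R)}{\mathrm{Var}_P(T_R)}=O_{\mathbb P}\big(\lambda_n^{-1}\big)=O_{\mathbb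 P}\big((np)^{-1}\big).$$ Here $X_n=O_{\mathbb P}(a_n)$ means that for every $\varepsilon>0$ there is $M>0$ with $\mathbb P(|X_n|>M|a_n|)\le\varepsilon$ for all large $n$. Uniformly over $i$ means that $M$ and the threshold for $n$ can be chosen the same for all nodes $i\in\{1,\dots,n\}$. -/

import Mathlib

open MeasureTheory ProbabilityTheory Filter Topology

noncomputable section

namespace NetworkBootstrap

/-- The positions `(i, j)`, `i < j`, of the upper-diagonal entries of an `n × n` matrix. -/
abbrev UpperPair (n : ℕ) : Type := {e : Fin n × Fin n // e.1 < e.2}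

/-- The network on `{0, …, n-1}` whose adjacency matrix has the upper-diagonal entries `ω`
(symmetric, no self-loops). -/
def networkOf {n : ℕ} (ω : UpperPair n → Bool) : SimpleGraph (Fin n) where
  Adj i j := (∃ h : i < j, ω ⟨(i, j), h⟩ = true) ∨ (∃ h : j < i, ω ⟨(j, i), h⟩ = true)
  symm := ⟨fun _ _ h => h.symm⟩
  loopless := ⟨fun i h => by rcases h with ⟨h, _⟩ | ⟨h, _⟩ <;> exact lt_irrefl i h⟩

/-- The law of a network `A ∼ P`: the upper-diagonal entries `A i j`, `i < j`, are independent
Bernoulli variables with success probabilities `P i j`. An entry of `P` outside `[0, 1]`, which is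
not a probability, is replaced by the nearest point of `[0, 1]`. -/
def networkLaw {n : ℕ} (P : Matrix (Fin n) (Fin n) ℝ) : Measure (SimpleGraph (Fin n)) :=
  (Measure.pi fun e : UpperPair n =>
    bernoulliMeasure true false (Set.projIcc (0 : ℝ) 1 zero_le_one (P e.1.1 e.1.2))).map networkOf

/-- The edge probabilities `P i j = p θ i θ j`, `i ≠ j`, with zero diagonal (no self-loops). -/
def chungLuMatrix {n : ℕ} (p : ℝ) (θ : Fin n → ℝ) : Matrix (Fin n) (Fin n) ℝ :=
  Matrix.of fun i j => if i = j then 0 else p * θ i * θ j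

/-- The average expected degree `λ = n⁻¹ ∑_{i, j} P i j`. -/
def avgExpectedDegree {n : ℕ} (P : Matrix (Fin n) (Fin n) ℝ) : ℝ :=
  (n : ℝ)⁻¹ * ∑ i, ∑ j, P i j

open Classical in
/-- The estimator `θ̂ i = ((n - 1) p)⁻¹ ∑_{j ≠ i} A i j`. -/
def thetaHat {n : ℕ} (p : ℝ) (A : SimpleGraph (Fin n)) (i : Fin n) : ℝ :=
  1 / (((n : ℝ) - 1) * p) * ∑ j ∈ Finset.univ.erase i, A.adjMatrix ℝ i j

/-- The estimator `P̂ i j = p θ̂ i θ̂ j`, `i ≠ j`. -/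
def pHat {n : ℕ} (p : ℝ) (A : SimpleGraph (Fin n)) : Matrix (Fin n) (Fin n) ℝ :=
  chungLuMatrix p (thetaHat p A)

/-- The global count `T_R(A)`: the number of subgraphs of `A` that are isomorphic to `R`. -/
def globalCount {W : Type*} (R : SimpleGraph W) {n : ℕ} (A : SimpleGraph (Fin n)) : ℝ :=
  (A.copyCount R : ℝ)

/-- The rooted count `T_R^{(i)}(A)` of the rooted graph `[R; r]`: the number of subgraphs of `A`
to which there is an isomorphism from `R` that maps the root `r` to the node `i`. -/
def rootedCount {W : Type*} (R : SimpleGraph W) (r : W) {n : ℕ} (i : Fin n)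
    (A : SimpleGraph (Fin n)) : ℝ :=
  ({G : A.Subgraph | ∃ f : R ≃g G.coe, ((f r : G.verts) : Fin n) = i}.ncard : ℝ)

/-- `Var_P(T)`: the variance of the statistic `T(A)` for `A ∼ P`. -/
def netVar {n : ℕ} (P : Matrix (Fin n) (Fin n) ℝ) (T : SimpleGraph (Fin n) → ℝ) : ℝ :=
  variance T (networkLaw P)

/-- The relative error `(Var_P̂(T) - Var_P(T)) / Var_P(T)` of the bootstrap variance as a function
of the observed network `A`, from which `P̂` is computed; `P` is the Chung-Lu matrix. -/
def relVarError {n : ℕ} (p : ℝ) (θ : Fin n → ℝ) (T : SimpleGraph (Fin n) → ℝ)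
    (A : SimpleGraph (Fin n)) : ℝ :=
  (netVar (pHat p A) T - netVar (chungLuMatrix p θ) T) / netVar (chungLuMatrix p θ) T

/-- `X n = O_ℙ(a n)` as `n → ∞`, where `X n` lives on the probability space `(Ω n, μ n)`. -/
def IsBigOInProb {Ω : ℕ → Type*} [∀ n, MeasurableSpace (Ω n)] (μ : ∀ n, Measure (Ω n))
    (X : ∀ n, Ω n → ℝ) (a : ℕ → ℝ) : Prop :=
  ∀ ε : ℝ, 0 < ε → ∃ M : ℝ, 0 < M ∧ ∀ᶠ n in atTop,
    μ n {ω | M * |a n| < |X n ω|} ≤ ENNReal.ofReal ε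

/-- `X n i = O_ℙ(a n)` as `n → ∞`, uniformly over the indices `i : ι n`. -/
def IsUnifBigOInProb {Ω ι : ℕ → Type*} [∀ n, MeasurableSpace (Ω n)] (μ : ∀ n, Measure (Ω n))
    (X : ∀ n, ι n → Ω n → ℝ) (a : ℕ → ℝ) : Prop :=
  ∀ ε : ℝ, 0 < ε → ∃ M : ℝ, 0 < M ∧ ∀ᶠ n in atTop, ∀ i : ι n,
    μ n {ω | M * |a n| < |X n i ω|} ≤ ENNReal.ofReal ε

instance measurableSingletonClass_simpleGraph {n : ℕ} :
    MeasurableSingletonClass (SimpleGraph (Fin n)) where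
  measurableSet_singleton G :=
    ⟨{G.Adj}, Set.Countable.measurableSet (Set.countable_singleton _), by
      ext H; simp⟩

theorem measurable_networkOf {n : ℕ} : Measurable (networkOf (n := n)) := measurable_of_countable _

instance isProbabilityMeasure_networkLaw {n : ℕ} (P : Matrix (Fin n) (Fin n) ℝ) :
    IsProbabilityMeasure (networkLaw P) :=
  Measure.isProbabilityMeasure_map measurable_networkOf.aemeasurable

end NetworkBootstrap

end

/-!
The count of copies of `R` in `A` is `∑ K ∈ 𝓚, 1[K ≤ A]`, where `𝓚` is the family of the images of
`R` (with the root at the prescribed node) in the complete graph; connectedness ensures that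
different subgraphs have different edges (`ncard_subgraph_eq_sum`). As the edges are independent,
its variance is the sum over pairs `K, K' ∈ 𝓚` of `P(K ⊔ K' ≤ A) - P(K ≤ A) P(K' ≤ A)`, which
vanishes unless `K` and `K'` share an edge, and which for edge probabilities `p x i x j` is a
difference of two monomials in `x`, with coefficients at most `w(K, K') = p ^ e(K ⊔ K')`
(`netVar_sum_le`, `netVar_chungLuMatrix_eq`). No classification of the possible overlaps is needed:
everything is compared with the total weight `W = ∑ w(K, K')` over the overlapping pairs.

* The variance at `θ` is at least a constant times `W`, since the subtracted product is smaller than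
  `P(K ⊔ K' ≤ A)` by a factor `p θ i θ j` (`totalWeight_le_countVar`).
* Let `δ = θ̂ - θ`, and let `W v` be the part of `W` from the pairs with an edge at the node `v`, so
  that `∑ v, W v = O(W)`. By Taylor expansion of the monomials, the variances at `θ̂` and `θ`
  differ by at most `C ∑ v, W v |δ v| (1 + |δ v|) ^ D`, and up to a linear term `∑ v, a v δ v` with
  `|a v| ≤ C W v` by at most `C ∑ v, W v |δ v| ^ 2 (1 + |δ v|) ^ D`
  (`exists_linear_approx_countVar`).
* A linear combination of centred edge indicators has exponential moments on the scale of its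
  standard deviation (`integral_exp_abs_edgeNoise_le`). Hence `E |δ v| ^ k (1 + |δ v|) ^ D` is
  `O((n p) ^ (-k / 2))`. Together with the first order expansion this gives the rate
  `(n p) ^ (-1 / 2)` for every count.
* The global count treats all nodes alike, so that `W v = O(W / n)` (`card_mul_nodeWeight_le`). The
  linear term then has coefficients of order `W / n`, and by cancellation between the nodes it is
  `O(W / (n √p)) = O(W / (n p))` (`integral_abs_sum_mul_thetaHat_sub_le`). The remainder of the
  second order expansion gives the rate `1 / (n p)`.

An estimated edge probability exceeds `1` only if some `|δ v|` is of order `p ^ (-1 / 2)`, which by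
Markov's inequality for the fourth moments has probability `O(1 / n)` (`relVarError_tail_le`).
-/

noncomputable section

namespace NetworkBootstrap

/-! ### Edges, the network law, and the variance of a count -/

open Classical in
/-- The positions of the edges of a graph `K` on `{0, …, n-1}`. -/
def edgePairs {n : ℕ} (K : SimpleGraph (Fin n)) : Finset (UpperPair n) :=
  Finset.univ.filter fun e => K.Adj e.1.1 e.1.2

lemma mem_edgePairs {n : ℕ} {K : SimpleGraph (Fin n)} {e : UpperPair n} :
    e ∈ edgePairs K ↔ K.Adj e.1.1 e.1.2 := by
  simp [edgePairs]

lemma edgePairs_sup {n : ℕ} (K K' : SimpleGraph (Fin n)) :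
    edgePairs (K ⊔ K') = edgePairs K ∪ edgePairs K' := by
  ext e; simp [mem_edgePairs]

open Classical in
lemma card_edgePairs {n : ℕ} (K : SimpleGraph (Fin n)) :
    (edgePairs K).card = K.edgeFinset.card := by
  refine Finset.card_bij (fun e _ => s(e.1.1, e.1.2)) ?_ ?_ ?_
  · intro e he
    simpa [mem_edgePairs] using he
  · rintro ⟨⟨a, b⟩, hab⟩ _ ⟨⟨c, d⟩, hcd⟩ _ h
    simp only [Sym2.eq_iff] at h
    rcases h with ⟨rfl, rfl⟩ | ⟨rfl, rfl⟩
    · rfl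
    · exact absurd hab (lt_asymm hcd)
  · intro b
    induction b using Sym2.ind with
    | _ x y =>
      intro h
      rw [SimpleGraph.mem_edgeFinset, SimpleGraph.mem_edgeSet] at h
      rcases lt_trichotomy x y with hxy | hxy | hxy
      · exact ⟨⟨(x, y), hxy⟩, mem_edgePairs.2 h, rfl⟩
      · exact absurd hxy h.ne
      · exact ⟨⟨(y, x), hxy⟩, mem_edgePairs.2 h.symm, Sym2.eq_swap⟩

lemma card_edgePairs_map {n : ℕ} {V : Type*} [Fintype V] (R : SimpleGraph V) (f : V ↪ Fin n) :
    (edgePairs (R.map f)).card = R.edgeSet.ncard := by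
  classical
  rw [card_edgePairs, ← SimpleGraph.coe_edgeFinset, Set.ncard_coe_finset]
  convert SimpleGraph.card_edgeFinset_map f R

lemma card_edgePairs_map_perm {n : ℕ} (σ : Equiv.Perm (Fin n)) (K : SimpleGraph (Fin n)) :
    (edgePairs (K.map σ)).card = (edgePairs K).card := by
  classical
  rw [show K.map σ = K.map σ.toEmbedding from rfl, card_edgePairs_map, card_edgePairs,
    ← SimpleGraph.coe_edgeFinset, Set.ncard_coe_finset]

lemma le_networkOf_iff {n : ℕ} {K : SimpleGraph (Fin n)} {ω : UpperPair n → Bool} :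
    K ≤ networkOf ω ↔ ∀ e ∈ edgePairs K, ω e = true := by
  constructor
  · rintro h ⟨⟨a, b⟩, hab⟩ he
    rcases h (mem_edgePairs.1 he) with ⟨_, h1⟩ | ⟨h1, _⟩
    · exact h1
    · exact absurd hab (lt_asymm h1)
  · intro h a b hab
    rcases lt_trichotomy a b with hlt | heq | hlt
    · exact Or.inl ⟨hlt, h ⟨(a, b), hlt⟩ (mem_edgePairs.2 hab)⟩
    · exact absurd heq hab.ne
    · exact Or.inr ⟨hlt, h ⟨(b, a), hlt⟩ (mem_edgePairs.2 hab.symm)⟩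

/-- The probability of an edge at position `e` under `networkLaw Q`: the entry of `Q`, moved to
`[0, 1]`. -/
def edgeProb {n : ℕ} (Q : Matrix (Fin n) (Fin n) ℝ) (e : UpperPair n) : ℝ :=
  (Set.projIcc (0 : ℝ) 1 zero_le_one (Q e.1.1 e.1.2) : ℝ)

lemma edgeProb_nonneg {n : ℕ} (Q : Matrix (Fin n) (Fin n) ℝ) (e : UpperPair n) :
    0 ≤ edgeProb Q e := (Set.projIcc (0 : ℝ) 1 zero_le_one _).2.1

lemma edgeProb_le_one {n : ℕ} (Q : Matrix (Fin n) (Fin n) ℝ) (e : UpperPair n) :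
    edgeProb Q e ≤ 1 := (Set.projIcc (0 : ℝ) 1 zero_le_one _).2.2

lemma edgeProb_of_mem {n : ℕ} {Q : Matrix (Fin n) (Fin n) ℝ} {e : UpperPair n}
    (h : Q e.1.1 e.1.2 ∈ Set.Icc (0 : ℝ) 1) : edgeProb Q e = Q e.1.1 e.1.2 := by
  rw [edgeProb, Set.projIcc_of_mem _ h]

lemma integral_networkLaw {n : ℕ} (Q : Matrix (Fin n) (Fin n) ℝ) (g : SimpleGraph (Fin n) → ℝ) :
    ∫ A, g A ∂networkLaw Q = ∫ ω, g (networkOf ω) ∂(Measure.pi fun e : UpperPair n =>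
      bernoulliMeasure true false (Set.projIcc (0 : ℝ) 1 zero_le_one (Q e.1.1 e.1.2))) := by
  rw [networkLaw, integral_map measurable_networkOf.aemeasurable]
  exact (measurable_of_countable _).aestronglyMeasurable

lemma integrable_networkLaw {n : ℕ} (Q : Matrix (Fin n) (Fin n) ℝ)
    (g : SimpleGraph (Fin n) → ℝ) : Integrable g (networkLaw Q) := Integrable.of_finite

/-- Independence of the edges. -/
lemma integral_networkLaw_prod {n : ℕ} (Q : Matrix (Fin n) (Fin n) ℝ)
    (g : SimpleGraph (Fin n) → ℝ) (f : UpperPair n → Bool → ℝ)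
    (hg : ∀ ω, g (networkOf ω) = ∏ e, f e (ω e)) :
    ∫ A, g A ∂networkLaw Q =
      ∏ e, (edgeProb Q e * f e true + (1 - edgeProb Q e) * f e false) := by
  rw [integral_networkLaw]
  simp_rw [hg]
  rw [integral_fintype_prod_eq_prod]
  refine Finset.prod_congr rfl fun e _ => ?_
  rw [integral_bernoulliMeasure]
  simp [edgeProb]

open Classical in
/-- The probability that `A` contains `K`. -/
lemma integral_networkLaw_le {n : ℕ} (Q : Matrix (Fin n) (Fin n) ℝ) (K : SimpleGraph (Fin n)) :
    ∫ A, (if K ≤ A then (1 : ℝ) else 0) ∂networkLaw Q = ∏ e ∈ edgePairs K, edgeProb Q e := by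
  rw [integral_networkLaw_prod Q _
    (fun e b => if e ∈ edgePairs K then (if b = true then 1 else 0) else 1)]
  · rw [← Finset.prod_subset (Finset.subset_univ (edgePairs K))]
    · refine Finset.prod_congr rfl fun e he => ?_
      simp [he]
    · intro e _ he
      simp [he]
  · intro ω
    simp_rw [le_networkOf_iff]
    rw [← Finset.prod_subset (Finset.subset_univ (edgePairs K))]
    · rw [Finset.prod_congr rfl (g := fun e => if ω e = true then (1 : ℝ) else 0)
        fun e he => by simp only [if_pos he], Finset.prod_ite_zero]
      simp
    · intro e _ he
      simp [he]

open Classical in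
lemma netVar_sum_le {n : ℕ} (Q : Matrix (Fin n) (Fin n) ℝ) (𝓚 : Finset (SimpleGraph (Fin n)))
    (T : SimpleGraph (Fin n) → ℝ) (hT : ∀ A, T A = ∑ K ∈ 𝓚, if K ≤ A then (1 : ℝ) else 0) :
    netVar Q T = ∑ K ∈ 𝓚, ∑ K' ∈ 𝓚, (∏ e ∈ edgePairs (K ⊔ K'), edgeProb Q e -
      (∏ e ∈ edgePairs K, edgeProb Q e) * ∏ e ∈ edgePairs K', edgeProb Q e) := by
  have hT' : T = fun A => ∑ K ∈ 𝓚, if K ≤ A then (1 : ℝ) else 0 := funext hT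
  rw [netVar, variance_eq_sub MemLp.of_discrete]
  have h1 : ∫ A, T A ∂networkLaw Q = ∑ K ∈ 𝓚, ∏ e ∈ edgePairs K, edgeProb Q e := by
    rw [hT', integral_finsetSum _ fun K _ => integrable_networkLaw Q _]
    simp_rw [integral_networkLaw_le]
  have h2 : ∫ A, (T ^ 2) A ∂networkLaw Q =
      ∑ K ∈ 𝓚, ∑ K' ∈ 𝓚, ∏ e ∈ edgePairs (K ⊔ K'), edgeProb Q e := by
    have : T ^ 2 = fun A => ∑ K ∈ 𝓚, ∑ K' ∈ 𝓚, if K ⊔ K' ≤ A then (1 : ℝ) else 0 := by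
      funext A
      -- both `K` and `K'` are contained in `A` exactly if `K ⊔ K'` is
      simp only [hT', Pi.pow_apply, sq, Finset.sum_mul_sum, sup_le_iff, ite_and, mul_ite, mul_one,
        mul_zero]
      refine Finset.sum_congr rfl fun K _ => Finset.sum_congr rfl fun K' _ => ?_
      split_ifs <;> rfl
    rw [this, integral_finsetSum _ fun K _ => integrable_networkLaw Q _]
    refine Finset.sum_congr rfl fun K _ => ?_
    rw [integral_finsetSum _ fun K _ => integrable_networkLaw Q _]
    simp_rw [integral_networkLaw_le]
  rw [h1, h2, sq, Finset.sum_mul_sum]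
  simp_rw [Finset.sum_sub_distrib]

/-! ### Taylor expansion of monomials -/

/-- Taylor expansion of a monomial at `θ`, to first and second order, as the multiset of its
variables grows. -/
lemma exists_linear_approx_multiset_prod {α : Type*} [Fintype α] {c : ℝ} (hc : 1 ≤ c) {θ : α → ℝ}
    (hθ : ∀ v, |θ v| ≤ c) (m : Multiset α) :
    ∃ a : α → ℝ, (∀ i, |a i| ≤ m.card * c ^ m.card) ∧ (∀ i, i ∉ m → a i = 0) ∧
      ∀ (δ : α → ℝ) (t : ℝ), 0 ≤ t → (∀ v ∈ m, |δ v| ≤ t) →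
        |(m.map fun v => θ v + δ v).prod - (m.map θ).prod| ≤
          (2 * c) ^ m.card * (t * (1 + t) ^ m.card) ∧
        |(m.map fun v => θ v + δ v).prod - (m.map θ).prod - ∑ i, a i * δ i| ≤
          (2 * c) ^ m.card * (t ^ 2 * (1 + t) ^ m.card) := by
  classical
  have hprod : ∀ m : Multiset α, |(m.map θ).prod| ≤ c ^ m.card := by
    intro m
    induction m using Multiset.induction with
    | empty => simp
    | cons x m ih =>
      rw [Multiset.map_cons, Multiset.prod_cons, Multiset.card_cons, pow_succ', abs_mul]
      exact mul_le_mul (hθ x) ih (abs_nonneg _) (by linarith)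
  induction m using Multiset.induction with
  | empty =>
    refine ⟨fun _ => 0, by simp, by simp, fun δ t ht _ => ?_⟩
    simp [ht]
  | cons x m ih =>
    obtain ⟨a, ha, ha0, h⟩ := ih
    refine ⟨fun i => θ x * a i + if i = x then (m.map θ).prod else 0, ?_, ?_, ?_⟩
    · intro i
      have hP := hprod m
      have h1 : |θ x * a i| ≤ c * (m.card * c ^ m.card) := by
        rw [abs_mul]
        exact mul_le_mul (hθ x) (ha i) (abs_nonneg _) (by linarith)
      have h2 : |if i = x then (m.map θ).prod else 0| ≤ c ^ m.card := by
        split_ifs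
        · exact hP
        · simp only [abs_zero]; positivity
      have h3 : c ^ m.card ≤ c * c ^ m.card := le_mul_of_one_le_left (by positivity) hc
      rw [Multiset.card_cons]
      push_cast
      calc _ ≤ _ := abs_add_le _ _
        _ ≤ c * (m.card * c ^ m.card) + c * c ^ m.card := by linarith
        _ = _ := by ring
    · intro i hi
      rw [Multiset.mem_cons, not_or] at hi
      simp [ha0 i hi.2, hi.1]
    · intro δ t ht hδ
      obtain ⟨h1, h2⟩ := h δ t ht fun v hv => hδ v (Multiset.mem_cons_of_mem hv)
      have hx := hδ x (Multiset.mem_cons_self x m)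
      have hsum : ∑ i, (θ x * a i + if i = x then (m.map θ).prod else 0) * δ i =
          θ x * ∑ i, a i * δ i + (m.map θ).prod * δ x := by
        simp only [add_mul, Finset.sum_add_distrib, ite_mul, zero_mul, Finset.sum_ite_eq',
          Finset.mem_univ, if_true, Finset.mul_sum, mul_assoc]
      rw [hsum]
      simp only [Multiset.map_cons, Multiset.prod_cons, Multiset.card_cons]
      have hP := hprod m
      have hck : c ^ m.card ≤ (2 * c) ^ m.card := pow_le_pow_left₀ (by linarith) (by linarith) _
      set k := m.card
      set A := (m.map fun v => θ v + δ v).prod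
      set B := (m.map θ).prod
      set S := ∑ i, a i * δ i
      have hT : 1 ≤ (1 + t) ^ k := one_le_pow₀ (by linarith)
      have hC0 : 0 ≤ (2 * c) ^ k := by positivity
      -- with `A`, `B` the monomials of `m` at `θ + δ` and at `θ`, and `S` the linear part, the
      -- error for `x ::ₘ m` is `(θ x + δ x) (A - B) + δ x B` to first order and
      -- `θ x (A - B - S) + δ x (A - B)` to second order
      constructor
      · calc |(θ x + δ x) * A - θ x * B| = |(θ x + δ x) * (A - B) + δ x * B| := by ring_nf
          _ ≤ |θ x + δ x| * |A - B| + |δ x| * |B| := by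
            rw [← abs_mul, ← abs_mul]; exact abs_add_le _ _
          _ ≤ (c + t) * ((2 * c) ^ k * (t * (1 + t) ^ k)) + t * (2 * c) ^ k := by
            have : |θ x + δ x| ≤ c + t := (abs_add_le _ _).trans (add_le_add (hθ x) hx)
            refine add_le_add (mul_le_mul this h1 (abs_nonneg _) (by linarith))
              (mul_le_mul hx (hP.trans hck) (abs_nonneg _) ht)
          _ ≤ (c * (1 + t)) * ((2 * c) ^ k * (t * (1 + t) ^ k)) +
              (c * (1 + t)) * ((2 * c) ^ k * (t * (1 + t) ^ k)) := by
            refine add_le_add (mul_le_mul_of_nonneg_right (by nlinarith) (by positivity)) ?_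
            have h3 : 1 ≤ (c * (1 + t)) * (1 + t) ^ k :=
              one_le_mul_of_one_le_of_one_le (by nlinarith) hT
            calc t * (2 * c) ^ k ≤ t * (2 * c) ^ k * ((c * (1 + t)) * (1 + t) ^ k) :=
                  le_mul_of_one_le_right (by positivity) h3
              _ = _ := by ring
          _ = _ := by ring
      · calc |(θ x + δ x) * A - θ x * B - (θ x * S + B * δ x)|
              = |θ x * (A - B - S) + δ x * (A - B)| := by ring_nf
          _ ≤ |θ x| * |A - B - S| + |δ x| * |A - B| := by
            rw [← abs_mul, ← abs_mul]; exact abs_add_le _ _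
          _ ≤ c * ((2 * c) ^ k * (t ^ 2 * (1 + t) ^ k)) + t * ((2 * c) ^ k * (t * (1 + t) ^ k)) :=
            add_le_add (mul_le_mul (hθ x) h2 (abs_nonneg _) (by linarith))
              (mul_le_mul hx h1 (abs_nonneg _) ht)
          _ = (c + 1) * ((2 * c) ^ k * (t ^ 2 * (1 + t) ^ k)) := by ring
          _ ≤ (2 * c * (1 + t)) * ((2 * c) ^ k * (t ^ 2 * (1 + t) ^ k)) :=
            mul_le_mul_of_nonneg_right (by nlinarith) (by positivity)
          _ = _ := by ring

/-- Taylor expansion of a monomial of degree at most `D`, with the remainder bounded by a sum over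
a set `U` that contains the variables. -/
lemma exists_linear_approx_monomial {α : Type*} [Fintype α] {c : ℝ} (hc : 1 ≤ c) {θ : α → ℝ}
    (hθ : ∀ v, |θ v| ≤ c) {m : Multiset α} {D : ℕ} (hD : m.card ≤ D) {U : Finset α}
    (hU : ∀ v ∈ m, v ∈ U) :
    ∃ a : α → ℝ, (∀ i, |a i| ≤ (D + 1) * (2 * c) ^ D) ∧ (∀ i, i ∉ U → a i = 0) ∧
      ∀ x : α → ℝ,
        |(m.map x).prod - (m.map θ).prod| ≤
          (D + 1) * (2 * c) ^ D * ∑ v ∈ U, |x v - θ v| * (1 + |x v - θ v|) ^ D ∧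
        |(m.map x).prod - (m.map θ).prod - ∑ i, a i * (x i - θ i)| ≤
          (D + 1) * (2 * c) ^ D * ∑ v ∈ U, |x v - θ v| ^ 2 * (1 + |x v - θ v|) ^ D := by
  classical
  obtain ⟨a, ha, ha0, h⟩ := exists_linear_approx_multiset_prod hc hθ m
  have hpow : (2 * c) ^ m.card ≤ (D + 1) * (2 * c) ^ D := by
    calc (2 * c) ^ m.card ≤ (2 * c) ^ D := pow_le_pow_right₀ (by linarith) hD
      _ ≤ _ := le_mul_of_one_le_left (by positivity) (by simp)
  refine ⟨a, fun i => (ha i).trans ?_, fun i hi => ha0 i fun h => hi (hU i h), fun x => ?_⟩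
  · have : (m.card : ℝ) ≤ D := by exact_mod_cast hD
    refine mul_le_mul (by linarith) ?_ (by positivity) (by positivity)
    calc c ^ m.card ≤ (2 * c) ^ m.card := pow_le_pow_left₀ (by linarith) (by linarith) _
      _ ≤ (2 * c) ^ D := pow_le_pow_right₀ (by linarith) hD
  · have hx : x = fun v => θ v + (x v - θ v) := by funext v; ring
    rcases m.toFinset.eq_empty_or_nonempty with hm | hm
    · rw [Multiset.toFinset_eq_empty] at hm
      obtain ⟨h1, h2⟩ := h (fun v => x v - θ v) 0 le_rfl (by simp [hm])
      simp only [← hx, zero_mul, mul_zero, ne_eq, OfNat.ofNat_ne_zero, not_false_eq_true,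
        zero_pow] at h1 h2
      exact ⟨h1.trans (by positivity), h2.trans (by positivity)⟩
    · -- the largest deviation among the variables controls the remainder
      obtain ⟨w, hw, hmax⟩ := Finset.exists_max_image m.toFinset (fun v => |x v - θ v|) hm
      obtain ⟨h1, h2⟩ := h (fun v => x v - θ v) |x w - θ w| (abs_nonneg _)
        fun v hv => hmax v (Multiset.mem_toFinset.2 hv)
      rw [← hx] at h1 h2
      have hwU : w ∈ U := hU w (Multiset.mem_toFinset.1 hw)
      have hT : (1 + |x w - θ w|) ^ m.card ≤ (1 + |x w - θ w|) ^ D :=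
        pow_le_pow_right₀ (by linarith [abs_nonneg (x w - θ w)]) hD
      constructor
      · refine h1.trans (mul_le_mul hpow ?_ (by positivity) (by positivity))
        refine (mul_le_mul_of_nonneg_left hT (abs_nonneg _)).trans ?_
        exact Finset.single_le_sum (f := fun v => |x v - θ v| * (1 + |x v - θ v|) ^ D)
          (fun v _ => by positivity) hwU
      · refine h2.trans (mul_le_mul hpow ?_ (by positivity) (by positivity))
        refine (mul_le_mul_of_nonneg_left hT (sq_nonneg _)).trans ?_
        exact Finset.single_le_sum (f := fun v => |x v - θ v| ^ 2 * (1 + |x v - θ v|) ^ D)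
          (fun v _ => by positivity) hwU

/-! ### Weights and the variance of a count as a polynomial -/

/-- The multiset of the endpoints of the edges in `E`: a vertex occurs as often as its degree. -/
def endpoints {n : ℕ} (E : Finset (UpperPair n)) : Multiset (Fin n) :=
  E.val.bind fun e => {e.1.1, e.1.2}

lemma card_endpoints {n : ℕ} (E : Finset (UpperPair n)) :
    (endpoints E).card = 2 * E.card := by
  simp only [endpoints, Multiset.card_bind, Function.comp_def]
  simp [mul_comm]

lemma mem_endpoints {n : ℕ} {E : Finset (UpperPair n)} {v : Fin n} :
    v ∈ endpoints E ↔ ∃ e ∈ E, v = e.1.1 ∨ v = e.1.2 := by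
  simp only [endpoints, Multiset.mem_bind, Finset.mem_val, Multiset.insert_eq_cons,
    Multiset.mem_cons, Multiset.mem_singleton]

lemma prod_edge_eq {n : ℕ} (p : ℝ) (x : Fin n → ℝ) (E : Finset (UpperPair n)) :
    ∏ e ∈ E, p * x e.1.1 * x e.1.2 = p ^ E.card * ((endpoints E).map x).prod := by
  have h : ((endpoints E).map x).prod = ∏ e ∈ E, x e.1.1 * x e.1.2 := by
    rw [endpoints, Multiset.map_bind, Multiset.prod_bind]
    simp only [Multiset.insert_eq_cons, Multiset.map_cons, Multiset.map_singleton,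
      Multiset.prod_cons, Multiset.prod_singleton]
    rfl
  rw [h, Finset.prod_congr rfl fun e _ => mul_assoc p (x e.1.1) (x e.1.2),
    Finset.prod_mul_distrib, Finset.prod_const]

/-- The covariance of the indicators of `E ⊆ A` and `E' ⊆ A` when edges `{i, j}` are present with
probability `p x i x j`. -/
def edgeCov {n : ℕ} (p : ℝ) (x : Fin n → ℝ) (E E' : Finset (UpperPair n)) : ℝ :=
  ∏ e ∈ E ∪ E', p * x e.1.1 * x e.1.2 -
    (∏ e ∈ E, p * x e.1.1 * x e.1.2) * ∏ e ∈ E', p * x e.1.1 * x e.1.2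

/-- The order of magnitude of the covariance of the indicators of `E ⊆ A` and `E' ⊆ A`; that `E`
and `E'` share an edge is expressed through cardinalities. -/
def overlapWeight {n : ℕ} (p : ℝ) (E E' : Finset (UpperPair n)) : ℝ :=
  if (E ∪ E').card < E.card + E'.card then p ^ (E ∪ E').card else 0

lemma overlapWeight_nonneg {n : ℕ} {p : ℝ} (hp : 0 ≤ p) (E E' : Finset (UpperPair n)) :
    0 ≤ overlapWeight p E E' := by
  unfold overlapWeight; split_ifs <;> positivity

lemma not_card_union_lt_iff {n : ℕ} {E E' : Finset (UpperPair n)} :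
    ¬ (E ∪ E').card < E.card + E'.card ↔ Disjoint E E' := by
  rw [← Finset.card_union_eq_card_add_card]
  have := Finset.card_union_le E E'
  omega

lemma edgeCov_of_disjoint {n : ℕ} (p : ℝ) (x : Fin n → ℝ) {E E' : Finset (UpperPair n)}
    (h : Disjoint E E') : edgeCov p x E E' = 0 := by
  rw [edgeCov, Finset.prod_union h, sub_self]

/-- A covariance is at least a constant times its order of magnitude: two sets of edges with a
common edge have `P(E) P(E') ≤ P(E ∪ E') / 2`. -/
lemma overlapWeight_le_edgeCov {n : ℕ} {p c c₀ : ℝ} (hp : 0 ≤ p) (hc : p * c ^ 2 ≤ 1 / 2)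
    (hc₀ : 0 < c₀) (hc₀1 : c₀ ≤ 1) {θ : Fin n → ℝ} (hθ₀ : ∀ v, c₀ ≤ θ v) (hθ : ∀ v, θ v ≤ c)
    {E E' : Finset (UpperPair n)} {m : ℕ} (hE : E.card ≤ m) (hE' : E'.card ≤ m) :
    c₀ ^ (4 * m) / 2 * overlapWeight p E E' ≤ edgeCov p θ E E' := by
  unfold overlapWeight
  split_ifs with h
  · have hq0 : ∀ e : UpperPair n, 0 ≤ p * θ e.1.1 * θ e.1.2 := fun e =>
      mul_nonneg (mul_nonneg hp (hc₀.le.trans (hθ₀ _))) (hc₀.le.trans (hθ₀ _))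
    have hq1 : ∀ e : UpperPair n, p * θ e.1.1 * θ e.1.2 ≤ 1 / 2 := fun e => by
      refine le_trans ?_ hc
      rw [mul_assoc, sq]
      exact mul_le_mul_of_nonneg_left (mul_le_mul (hθ _) (hθ _) (hc₀.le.trans (hθ₀ _))
        (hc₀.le.trans ((hθ₀ e.1.1).trans (hθ _)))) hp
    have hne : (E ∩ E').Nonempty := by
      rw [Finset.nonempty_iff_ne_empty, ne_eq, ← Finset.disjoint_iff_inter_eq_empty,
        ← not_card_union_lt_iff]
      simpa using h
    obtain ⟨e₀, he₀⟩ := hne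
    -- the probabilities of `E ∪ E'` and `E ∩ E'` multiply to those of `E` and `E'`
    have hI : ∏ e ∈ E ∩ E', p * θ e.1.1 * θ e.1.2 ≤ 1 / 2 := by
      rw [← Finset.mul_prod_erase _ _ he₀]
      have : ∏ e ∈ (E ∩ E').erase e₀, p * θ e.1.1 * θ e.1.2 ≤ 1 :=
        Finset.prod_le_one (fun e _ => hq0 e) fun e _ => (hq1 e).trans (by norm_num)
      calc _ ≤ 1 / 2 * (1 : ℝ) :=
            mul_le_mul (hq1 e₀) this (Finset.prod_nonneg fun e _ => hq0 e) (by norm_num)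
        _ = 1 / 2 := by norm_num
    have hU : p ^ (E ∪ E').card * c₀ ^ (4 * m) ≤ ∏ e ∈ E ∪ E', p * θ e.1.1 * θ e.1.2 := by
      have h1 : c₀ ^ (4 * m) ≤ c₀ ^ (2 * (E ∪ E').card) :=
        pow_le_pow_of_le_one hc₀.le hc₀1 (by have := Finset.card_union_le E E'; omega)
      have h2 : ∏ e ∈ E ∪ E', p * c₀ * c₀ ≤ ∏ e ∈ E ∪ E', p * θ e.1.1 * θ e.1.2 :=
        Finset.prod_le_prod (fun e _ => by positivity) fun e _ =>
          mul_le_mul (mul_le_mul_of_nonneg_left (hθ₀ _) hp) (hθ₀ _) hc₀.le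
            (mul_nonneg hp (hc₀.le.trans (hθ₀ _)))
      refine le_trans ?_ h2
      rw [Finset.prod_const, mul_assoc, mul_pow, ← sq, ← pow_mul]
      exact mul_le_mul_of_nonneg_left h1 (by positivity)
    have hU0 : 0 ≤ ∏ e ∈ E ∪ E', p * θ e.1.1 * θ e.1.2 := Finset.prod_nonneg fun e _ => hq0 e
    rw [edgeCov, ← Finset.prod_union_inter]
    nlinarith
  · rw [not_card_union_lt_iff] at h
    rw [edgeCov_of_disjoint p θ h, mul_zero]

/-- Taylor expansion of a covariance in the parameters `x` at `θ`. -/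
lemma exists_linear_approx_edgeCov {n : ℕ} {p c : ℝ} (hp : 0 ≤ p) (hp1 : p ≤ 1) (hc : 1 ≤ c)
    {θ : Fin n → ℝ} (hθ : ∀ v, |θ v| ≤ c) {E E' : Finset (UpperPair n)} {m : ℕ}
    (hE : E.card ≤ m) (hE' : E'.card ≤ m) {D : ℕ} (hD : D = 4 * m) {C : ℝ}
    (hC : C = 2 * ((D + 1) * (2 * c) ^ D)) :
    ∃ a : Fin n → ℝ,
      (∀ i, |a i| ≤ C * if i ∈ endpoints (E ∪ E') then overlapWeight p E E' else 0) ∧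
      ∀ x : Fin n → ℝ,
        |edgeCov p x E E' - edgeCov p θ E E'| ≤
          C * ∑ v, (if v ∈ endpoints (E ∪ E') then overlapWeight p E E' else 0) *
            (|x v - θ v| * (1 + |x v - θ v|) ^ D) ∧
        |edgeCov p x E E' - edgeCov p θ E E' - ∑ i, a i * (x i - θ i)| ≤
          C * ∑ v, (if v ∈ endpoints (E ∪ E') then overlapWeight p E E' else 0) *
            (|x v - θ v| ^ 2 * (1 + |x v - θ v|) ^ D) := by
  classical
  unfold overlapWeight
  split_ifs with h
  · have hcard := Finset.card_union_le E E'
    set U := (endpoints (E ∪ E')).toFinset with hU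
    obtain ⟨a₁, ha₁, ha₁0, h₁⟩ := exists_linear_approx_monomial hc hθ (D := D)
      (m := endpoints (E ∪ E')) (U := U) (by rw [card_endpoints]; omega)
      fun v hv => Multiset.mem_toFinset.2 hv
    obtain ⟨a₂, ha₂, ha₂0, h₂⟩ := exists_linear_approx_monomial hc hθ (D := D)
      (m := endpoints E + endpoints E') (U := U)
      (by rw [Multiset.card_add, card_endpoints, card_endpoints]; omega)
      (by
        intro v hv
        rw [hU, Multiset.mem_toFinset, mem_endpoints]
        rcases Multiset.mem_add.1 hv with hv | hv <;> obtain ⟨e, he, hve⟩ := mem_endpoints.1 hv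
        exacts [⟨e, Finset.mem_union_left _ he, hve⟩, ⟨e, Finset.mem_union_right _ he, hve⟩])
    set B : ℝ := (D + 1) * (2 * c) ^ D with hB
    have hB0 : 0 ≤ B := by positivity
    set w := p ^ (E ∪ E').card with hw
    set w' := p ^ (E.card + E'.card) with hw'
    have hw0 : 0 ≤ w := by positivity
    have hw'0 : 0 ≤ w' := by positivity
    -- the product of the probabilities carries the higher power of `p`, as `E` and `E'` overlap
    have hw'w : w' ≤ w := pow_le_pow_of_le_one hp hp1 h.le
    have hcov : ∀ x : Fin n → ℝ, edgeCov p x E E' =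
        w * ((endpoints (E ∪ E')).map x).prod -
          w' * ((endpoints E + endpoints E').map x).prod := by
      intro x
      rw [edgeCov, prod_edge_eq, prod_edge_eq, prod_edge_eq, Multiset.map_add, Multiset.prod_add,
        hw', pow_add]
      ring
    have hsum : ∀ f : Fin n → ℝ, ∑ v, (if v ∈ endpoints (E ∪ E') then w else 0) * f v =
        w * ∑ v ∈ U, f v := by
      intro f
      simp only [ite_mul, zero_mul, ← Finset.sum_filter, Finset.mul_sum]
      refine Finset.sum_congr ?_ fun _ _ => rfl
      ext v; simp [hU]
    have hcomb : ∀ s t u : ℝ, |s| ≤ B * u → |t| ≤ B * u → |w * s - w' * t| ≤ C * (w * u) := by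
      intro s t u hs ht
      calc |w * s - w' * t| ≤ |w * s| + |w' * t| := abs_sub _ _
        _ = w * |s| + w' * |t| := by rw [abs_mul, abs_mul, abs_of_nonneg hw0, abs_of_nonneg hw'0]
        _ ≤ w * (B * u) + w * (B * u) := by
          refine add_le_add (mul_le_mul_of_nonneg_left hs hw0) ?_
          exact mul_le_mul hw'w ht (abs_nonneg _) hw0
        _ = C * (w * u) := by rw [hC]; ring
    refine ⟨fun i => w * a₁ i - w' * a₂ i, ?_, ?_⟩
    · intro i
      split_ifs with hi
      · simpa using hcomb (a₁ i) (a₂ i) 1 (by simpa using ha₁ i) (by simpa using ha₂ i)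
      · have : i ∉ U := by simpa [hU] using hi
        simp [ha₁0 i this, ha₂0 i this]
    · intro x
      rw [hsum, hsum, hcov, hcov]
      have h3 : ∑ i, (w * a₁ i - w' * a₂ i) * (x i - θ i) =
          w * ∑ i, a₁ i * (x i - θ i) - w' * ∑ i, a₂ i * (x i - θ i) := by
        rw [Finset.mul_sum, Finset.mul_sum, ← Finset.sum_sub_distrib]
        exact Finset.sum_congr rfl fun i _ => by ring
      constructor
      · refine le_trans (le_of_eq ?_) (hcomb _ _ _ (h₁ x).1 (h₂ x).1)
        congr 1; ring
      · refine le_trans (le_of_eq ?_) (hcomb _ _ _ (h₁ x).2 (h₂ x).2)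
        rw [h3]; congr 1; ring
  · rw [not_card_union_lt_iff] at h
    refine ⟨fun _ => 0, by simp, fun x => ?_⟩
    simp [edgeCov_of_disjoint _ _ h]

/-- The total order of magnitude of the covariances of the indicators of `K ≤ A`, `K ∈ 𝓚`. -/
def totalWeight {n : ℕ} (p : ℝ) (𝓚 : Finset (SimpleGraph (Fin n))) : ℝ :=
  ∑ K ∈ 𝓚, ∑ K' ∈ 𝓚, overlapWeight p (edgePairs K) (edgePairs K')

/-- The part of `totalWeight` that comes from the pairs of graphs with an edge at `j`. -/
def nodeWeight {n : ℕ} (p : ℝ) (𝓚 : Finset (SimpleGraph (Fin n))) (j : Fin n) : ℝ :=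
  ∑ K ∈ 𝓚, ∑ K' ∈ 𝓚, if j ∈ endpoints (edgePairs K ∪ edgePairs K') then
    overlapWeight p (edgePairs K) (edgePairs K') else 0

/-- The variance of the number of `K ∈ 𝓚` with `K ≤ A`, when edges `{i, j}` are present with
probability `p x i x j`. -/
def countVar {n : ℕ} (p : ℝ) (𝓚 : Finset (SimpleGraph (Fin n))) (x : Fin n → ℝ) : ℝ :=
  ∑ K ∈ 𝓚, ∑ K' ∈ 𝓚, edgeCov p x (edgePairs K) (edgePairs K')

lemma nodeWeight_nonneg {n : ℕ} {p : ℝ} (hp : 0 ≤ p) (𝓚 : Finset (SimpleGraph (Fin n)))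
    (j : Fin n) : 0 ≤ nodeWeight p 𝓚 j :=
  Finset.sum_nonneg fun K _ => Finset.sum_nonneg fun K' _ => by
    split_ifs
    exacts [overlapWeight_nonneg hp _ _, le_rfl]

lemma totalWeight_pos {n : ℕ} {p : ℝ} (hp : 0 < p) {𝓚 : Finset (SimpleGraph (Fin n))}
    (h𝓚 : 𝓚.Nonempty) (hcard : ∀ K ∈ 𝓚, 0 < (edgePairs K).card) : 0 < totalWeight p 𝓚 := by
  obtain ⟨K, hK⟩ := h𝓚
  have h0 : ∀ K' ∈ 𝓚, ∀ K'' ∈ 𝓚, 0 ≤ overlapWeight p (edgePairs K') (edgePairs K'') :=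
    fun _ _ _ _ => overlapWeight_nonneg hp.le _ _
  refine Finset.sum_pos' (fun K' hK' => Finset.sum_nonneg (h0 K' hK')) ⟨K, hK, ?_⟩
  refine Finset.sum_pos' (h0 K hK) ⟨K, hK, ?_⟩
  have := hcard K hK
  rw [overlapWeight, Finset.union_self, if_pos (by omega)]
  positivity

lemma totalWeight_le_countVar {n : ℕ} {p c c₀ : ℝ} (hp : 0 ≤ p) (hc : p * c ^ 2 ≤ 1 / 2)
    (hc₀ : 0 < c₀) (hc₀1 : c₀ ≤ 1) {θ : Fin n → ℝ} (hθ₀ : ∀ v, c₀ ≤ θ v) (hθ : ∀ v, θ v ≤ c)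
    {𝓚 : Finset (SimpleGraph (Fin n))} {m : ℕ} (hm : ∀ K ∈ 𝓚, (edgePairs K).card ≤ m) :
    c₀ ^ (4 * m) / 2 * totalWeight p 𝓚 ≤ countVar p 𝓚 θ := by
  rw [totalWeight, countVar, Finset.mul_sum]
  refine Finset.sum_le_sum fun K hK => ?_
  rw [Finset.mul_sum]
  exact Finset.sum_le_sum fun K' hK' =>
    overlapWeight_le_edgeCov hp hc hc₀ hc₀1 hθ₀ hθ (hm K hK) (hm K' hK')

/-- Taylor expansion of the variance of a count in the parameters `x` at `θ`, with the contribution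
of each node controlled by its weight. -/
lemma exists_linear_approx_countVar {n : ℕ} {p c : ℝ} (hp : 0 ≤ p) (hp1 : p ≤ 1) (hc : 1 ≤ c)
    {θ : Fin n → ℝ} (hθ : ∀ v, |θ v| ≤ c) {𝓚 : Finset (SimpleGraph (Fin n))} {m : ℕ}
    (hm : ∀ K ∈ 𝓚, (edgePairs K).card ≤ m) {D : ℕ} (hD : D = 4 * m) {C : ℝ}
    (hC : C = 2 * ((D + 1) * (2 * c) ^ D)) :
    ∃ a : Fin n → ℝ, (∀ i, |a i| ≤ C * nodeWeight p 𝓚 i) ∧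
      ∀ x : Fin n → ℝ,
        |countVar p 𝓚 x - countVar p 𝓚 θ| ≤
          C * ∑ v, nodeWeight p 𝓚 v * (|x v - θ v| * (1 + |x v - θ v|) ^ D) ∧
        |countVar p 𝓚 x - countVar p 𝓚 θ - ∑ i, a i * (x i - θ i)| ≤
          C * ∑ v, nodeWeight p 𝓚 v * (|x v - θ v| ^ 2 * (1 + |x v - θ v|) ^ D) := by
  classical
  have key : ∀ z : SimpleGraph (Fin n) × SimpleGraph (Fin n), z ∈ 𝓚 ×ˢ 𝓚 → _ := fun z hz =>
    exists_linear_approx_edgeCov hp hp1 hc hθ (hm z.1 (Finset.mem_product.1 hz).1)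
      (hm z.2 (Finset.mem_product.1 hz).2) hD hC
  choose! a ha hx using key
  have hvar : ∀ x, countVar p 𝓚 x =
      ∑ z ∈ 𝓚 ×ˢ 𝓚, edgeCov p x (edgePairs z.1) (edgePairs z.2) := fun x => by
    rw [countVar, Finset.sum_product]
  have hnode : ∀ v, nodeWeight p 𝓚 v = ∑ z ∈ 𝓚 ×ˢ 𝓚,
      if v ∈ endpoints (edgePairs z.1 ∪ edgePairs z.2) then
        overlapWeight p (edgePairs z.1) (edgePairs z.2) else 0 := fun v => by
    rw [nodeWeight, Finset.sum_product]
  have hsum : ∀ f : Fin n → ℝ, C * ∑ v, nodeWeight p 𝓚 v * f v = ∑ z ∈ 𝓚 ×ˢ 𝓚,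
      C * ∑ v, (if v ∈ endpoints (edgePairs z.1 ∪ edgePairs z.2) then
        overlapWeight p (edgePairs z.1) (edgePairs z.2) else 0) * f v := fun f => by
    rw [← Finset.mul_sum, Finset.sum_comm]
    simp_rw [hnode, Finset.sum_mul]
  refine ⟨fun i => ∑ z ∈ 𝓚 ×ˢ 𝓚, a z i, fun i => ?_, fun x => ⟨?_, ?_⟩⟩
  · rw [hnode, Finset.mul_sum]
    exact (Finset.abs_sum_le_sum_abs _ _).trans (Finset.sum_le_sum fun z hz => ha z hz i)
  · rw [hvar, hvar, hsum, ← Finset.sum_sub_distrib]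
    exact (Finset.abs_sum_le_sum_abs _ _).trans (Finset.sum_le_sum fun z hz => (hx z hz x).1)
  · have : ∑ i, (∑ z ∈ 𝓚 ×ˢ 𝓚, a z i) * (x i - θ i) =
        ∑ z ∈ 𝓚 ×ˢ 𝓚, ∑ i, a z i * (x i - θ i) := by
      simp_rw [Finset.sum_mul]
      exact Finset.sum_comm
    rw [hvar, hvar, hsum, this, ← Finset.sum_sub_distrib, ← Finset.sum_sub_distrib]
    exact (Finset.abs_sum_le_sum_abs _ _).trans (Finset.sum_le_sum fun z hz => (hx z hz x).2)

open Classical in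
/-- As long as no edge probability has to be moved to `[0, 1]`, the variance of a count is a
polynomial in the parameters. -/
lemma netVar_chungLuMatrix_eq {n : ℕ} {p : ℝ} {x : Fin n → ℝ}
    (hx : ∀ i j, 0 ≤ p * x i * x j ∧ p * x i * x j ≤ 1) {𝓚 : Finset (SimpleGraph (Fin n))}
    {T : SimpleGraph (Fin n) → ℝ} (hT : ∀ A, T A = ∑ K ∈ 𝓚, if K ≤ A then (1 : ℝ) else 0) :
    netVar (chungLuMatrix p x) T = countVar p 𝓚 x := by
  have hq : edgeProb (chungLuMatrix p x) = fun e => p * x e.1.1 * x e.1.2 := by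
    funext e
    have he : chungLuMatrix p x e.1.1 e.1.2 = p * x e.1.1 * x e.1.2 := by
      simp [chungLuMatrix, e.2.ne]
    rw [edgeProb_of_mem (by rw [he]; exact hx _ _), he]
  rw [netVar_sum_le _ 𝓚 T hT, countVar, hq]
  simp only [edgeCov, edgePairs_sup]

/-- Every pair of graphs with at most `m` edges each contributes to at most `4 m` nodes. -/
lemma sum_nodeWeight_le {n : ℕ} {p : ℝ} (hp : 0 ≤ p) {𝓚 : Finset (SimpleGraph (Fin n))}
    {m : ℕ} (hm : ∀ K ∈ 𝓚, (edgePairs K).card ≤ m) :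
    ∑ i, nodeWeight p 𝓚 i ≤ 4 * m * totalWeight p 𝓚 := by
  classical
  calc ∑ i, nodeWeight p 𝓚 i
    _ = ∑ K ∈ 𝓚, ∑ K' ∈ 𝓚, ∑ i, if i ∈ endpoints (edgePairs K ∪ edgePairs K') then
          overlapWeight p (edgePairs K) (edgePairs K') else 0 := by
        simp only [nodeWeight]
        rw [Finset.sum_comm]
        exact Finset.sum_congr rfl fun K _ => Finset.sum_comm
    _ ≤ 4 * m * totalWeight p 𝓚 := by
        rw [totalWeight, Finset.mul_sum]
        refine Finset.sum_le_sum fun K hK => ?_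
        rw [Finset.mul_sum]
        refine Finset.sum_le_sum fun K' hK' => ?_
        rw [← Finset.sum_filter, Finset.sum_const, nsmul_eq_mul]
        refine mul_le_mul_of_nonneg_right ?_ (overlapWeight_nonneg hp _ _)
        have h1 : (Finset.univ.filter fun i => i ∈ endpoints (edgePairs K ∪ edgePairs K')).card ≤
            (endpoints (edgePairs K ∪ edgePairs K')).card := by
          refine le_trans (Finset.card_le_card ?_) (Multiset.toFinset_card_le _)
          intro i hi
          simpa using hi
        have h2 := Finset.card_union_le (edgePairs K) (edgePairs K')
        have h3 := hm K hK
        have h4 := hm K' hK'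
        rw [card_endpoints] at h1
        have : (Finset.univ.filter fun i => i ∈ endpoints (edgePairs K ∪ edgePairs K')).card ≤
          4 * m := by omega
        exact_mod_cast this

/-- If the family of graphs is invariant under transpositions of the nodes, then all nodes have the
same weight, at most of order `1 / n` of the total weight. -/
lemma card_mul_nodeWeight_le {n : ℕ} {p : ℝ} (hp : 0 ≤ p) {𝓚 : Finset (SimpleGraph (Fin n))}
    {m : ℕ} (hm : ∀ K ∈ 𝓚, (edgePairs K).card ≤ m)
    (hS : ∀ i j, ∀ K ∈ 𝓚, K.map (Equiv.swap i j) ∈ 𝓚) (j : Fin n) :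
    n * nodeWeight p 𝓚 j ≤ 4 * m * totalWeight p 𝓚 := by
  classical
  have hmem : ∀ (K K' : SimpleGraph (Fin n)) (v : Fin n),
      v ∈ endpoints (edgePairs K ∪ edgePairs K') ↔ ∃ u, (K ⊔ K').Adj v u := by
    intro K K' v
    rw [mem_endpoints, ← edgePairs_sup]
    constructor
    · rintro ⟨e, he, rfl | rfl⟩
      exacts [⟨_, mem_edgePairs.1 he⟩, ⟨_, (mem_edgePairs.1 he).symm⟩]
    · rintro ⟨u, hu⟩
      rcases lt_trichotomy v u with hlt | heq | hlt
      · exact ⟨⟨(v, u), hlt⟩, mem_edgePairs.2 hu, Or.inl rfl⟩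
      · exact absurd heq hu.ne
      · exact ⟨⟨(u, v), hlt⟩, mem_edgePairs.2 hu.symm, Or.inr rfl⟩
  have hadj' : ∀ (σ : Equiv.Perm (Fin n)) (K : SimpleGraph (Fin n)) (a b : Fin n),
      (K.map σ).Adj a b ↔ K.Adj (σ.symm a) (σ.symm b) := by
    intro σ K a b
    have := SimpleGraph.map_adj_apply (G := K) (f := σ.toEmbedding) (a := σ.symm a)
      (b := σ.symm b)
    simpa using this
  have hmap : ∀ (σ : Equiv.Perm (Fin n)) (K K' : SimpleGraph (Fin n)),
      K.map σ ⊔ K'.map σ = (K ⊔ K').map σ := by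
    intro σ K K'
    ext a b
    simp only [SimpleGraph.sup_adj, hadj']
  have hw : ∀ (σ : Equiv.Perm (Fin n)) (K K' : SimpleGraph (Fin n)),
      overlapWeight p (edgePairs (K.map σ)) (edgePairs (K'.map σ)) =
        overlapWeight p (edgePairs K) (edgePairs K') := by
    intro σ K K'
    simp only [overlapWeight, ← edgePairs_sup, hmap, card_edgePairs_map_perm]
  have hadj : ∀ (σ : Equiv.Perm (Fin n)) (K : SimpleGraph (Fin n)) (v : Fin n),
      (∃ u, (K.map σ).Adj (σ v) u) ↔ ∃ u, K.Adj v u := by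
    intro σ K v
    simp only [hadj', Equiv.symm_apply_apply]
    exact σ.symm.surjective.exists.symm
  have heq : ∀ i, nodeWeight p 𝓚 i = nodeWeight p 𝓚 j := by
    intro i
    set σ := Equiv.swap i j with hσ
    have hinv : ∀ K : SimpleGraph (Fin n), (K.map σ).map σ = K := by
      intro K
      rw [SimpleGraph.map_map, hσ, ← Equiv.coe_trans, Equiv.swap_swap]
      exact SimpleGraph.map_id K
    have hσi : σ i = j := Equiv.swap_apply_left i j
    rw [nodeWeight, nodeWeight, ← Finset.sum_product', ← Finset.sum_product']
    -- the transposition of `i` and `j`, applied to both graphs, is a bijection between the pairs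
    refine Finset.sum_nbij' (fun z => (z.1.map σ, z.2.map σ)) (fun z => (z.1.map σ, z.2.map σ))
      ?_ ?_ ?_ ?_ ?_
    · intro z hz
      rw [Finset.mem_product] at hz ⊢
      exact ⟨hS i j _ hz.1, hS i j _ hz.2⟩
    · intro z hz
      rw [Finset.mem_product] at hz ⊢
      exact ⟨hS i j _ hz.1, hS i j _ hz.2⟩
    · intro z _
      simp only [hinv]
    · intro z _
      simp only [hinv]
    · intro z _
      simp only [hw, hmem, hmap]
      simp only [← hσi, hadj]
  calc n * nodeWeight p 𝓚 j = ∑ i, nodeWeight p 𝓚 i := by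
        rw [Finset.sum_congr rfl fun i _ => heq i, Finset.sum_const, nsmul_eq_mul,
          Finset.card_univ, Fintype.card_fin]
    _ ≤ _ := sum_nodeWeight_le hp hm

/-! ### Exponential moments of the edge noise -/

open Classical in
/-- The linear combination of the centred edge indicators with coefficients `b`. -/
def edgeNoise {n : ℕ} (Q : Matrix (Fin n) (Fin n) ℝ) (b : UpperPair n → ℝ)
    (A : SimpleGraph (Fin n)) : ℝ :=
  ∑ e, b e * ((if A.Adj e.1.1 e.1.2 then 1 else 0) - edgeProb Q e)

lemma networkOf_adj {n : ℕ} (ω : UpperPair n → Bool) (e : UpperPair n) :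
    (networkOf ω).Adj e.1.1 e.1.2 ↔ ω e = true := by
  constructor
  · rintro (⟨_, h⟩ | ⟨h, _⟩)
    · exact h
    · exact absurd e.2 (lt_asymm h)
  · exact fun h => Or.inl ⟨e.2, h⟩

/-- The moment generating function of a centred Bernoulli variable is at most that of a Gaussian
variable with variance `2 q`, near `0`. -/
lemma bernoulli_mgf_le {q t : ℝ} (hq : 0 ≤ q) (ht : |t| ≤ 1) :
    q * Real.exp (t * (1 - q)) + (1 - q) * Real.exp (t * (0 - q)) ≤ Real.exp (t ^ 2 * q) := by
  have h1 : q * Real.exp (t * (1 - q)) + (1 - q) * Real.exp (t * (0 - q)) =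
      Real.exp (-(t * q)) * (q * (Real.exp t - 1) + 1) := by
    rw [show t * (1 - q) = -(t * q) + t by ring, show t * (0 - q) = -(t * q) by ring, Real.exp_add]
    ring
  have h2 := Real.add_one_le_exp (q * (Real.exp t - 1))
  have h3 := (abs_le.1 (Real.abs_exp_sub_one_sub_id_le ht)).2
  rw [h1]
  calc _ ≤ Real.exp (-(t * q)) * Real.exp (q * (Real.exp t - 1)) :=
        mul_le_mul_of_nonneg_left h2 (Real.exp_pos _).le
    _ = Real.exp (q * (Real.exp t - 1 - t)) := by rw [← Real.exp_add]; ring_nf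
    _ ≤ _ := Real.exp_le_exp.2 (by nlinarith)

lemma integral_exp_edgeNoise_le {n : ℕ} (Q : Matrix (Fin n) (Fin n) ℝ) {b : UpperPair n → ℝ}
    (hb : ∀ e, |b e| ≤ 1) (hV : ∑ e, b e ^ 2 * edgeProb Q e ≤ 1) :
    ∫ A, Real.exp (edgeNoise Q b A) ∂networkLaw Q ≤ Real.exp 1 := by
  rw [integral_networkLaw_prod Q _
    (fun e z => Real.exp (b e * ((if z = true then 1 else 0) - edgeProb Q e)))]
  · calc _ ≤ ∏ e, Real.exp (b e ^ 2 * edgeProb Q e) := by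
          refine Finset.prod_le_prod (fun e _ => ?_) fun e _ => ?_
          · have h0 := edgeProb_nonneg Q e
            have h1 := sub_nonneg.2 (edgeProb_le_one Q e)
            positivity
          · simpa using bernoulli_mgf_le (edgeProb_nonneg Q e) (hb e)
      _ = Real.exp (∑ e, b e ^ 2 * edgeProb Q e) := (Real.exp_sum _ _).symm
      _ ≤ _ := Real.exp_le_exp.2 hV
  · intro ω
    rw [← Real.exp_sum]
    simp only [edgeNoise, networkOf_adj]

/-- A linear combination of centred edge indicators has exponential moments on the scale of its
standard deviation, provided that no coefficient exceeds this scale. -/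
lemma integral_exp_abs_edgeNoise_le {n : ℕ} (Q : Matrix (Fin n) (Fin n) ℝ) {b : UpperPair n → ℝ}
    {s : ℝ} (hs : 0 < s) (hb : ∀ e, |b e| ≤ s) (hV : ∑ e, b e ^ 2 * edgeProb Q e ≤ s ^ 2) :
    ∫ A, Real.exp (|edgeNoise Q b A| / s) ∂networkLaw Q ≤ 2 * Real.exp 1 := by
  have hscale : ∀ (r : ℝ) (A : SimpleGraph (Fin n)),
      edgeNoise Q (fun e => r * b e) A = r * edgeNoise Q b A := by
    intro r A
    simp only [edgeNoise, Finset.mul_sum, mul_assoc]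
  -- `exp |x| ≤ exp x + exp (-x)`, so the two signs can be treated separately
  have hside : ∀ r : ℝ, |r| = 1 / s →
      ∫ A, Real.exp (r * edgeNoise Q b A) ∂networkLaw Q ≤ Real.exp 1 := by
    intro r hr
    simp_rw [← hscale]
    refine integral_exp_edgeNoise_le Q (fun e => ?_) ?_
    · rw [abs_mul, hr, one_div, inv_mul_le_iff₀ hs, mul_one]
      exact hb e
    · have hr2 : r ^ 2 = 1 / s ^ 2 := by rw [← sq_abs, hr, div_pow, one_pow]
      simp_rw [mul_pow, mul_assoc]
      rw [← Finset.mul_sum, hr2, one_div, inv_mul_le_iff₀ (by positivity), mul_one]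
      exact hV
  have h1 := hside (1 / s) (abs_of_pos (by positivity))
  have h2 := hside (-(1 / s)) (by rw [abs_neg, abs_of_pos (by positivity)])
  calc ∫ A, Real.exp (|edgeNoise Q b A| / s) ∂networkLaw Q
      ≤ ∫ A, (Real.exp (1 / s * edgeNoise Q b A) + Real.exp (-(1 / s) * edgeNoise Q b A))
          ∂networkLaw Q := by
        refine integral_mono (integrable_networkLaw Q _) (integrable_networkLaw Q _) fun A => ?_
        have e1 := Real.exp_pos (1 / s * edgeNoise Q b A)
        have e2 := Real.exp_pos (-(1 / s) * edgeNoise Q b A)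
        rcases abs_cases (edgeNoise Q b A) with ⟨h, _⟩ | ⟨h, _⟩
        · simp only [h]
          rw [show edgeNoise Q b A / s = 1 / s * edgeNoise Q b A by ring]
          linarith
        · simp only [h]
          rw [show -edgeNoise Q b A / s = -(1 / s) * edgeNoise Q b A by ring]
          linarith
    _ ≤ Real.exp 1 + Real.exp 1 := by
        rw [integral_add (integrable_networkLaw Q _) (integrable_networkLaw Q _)]
        exact add_le_add h1 h2
    _ = _ := by ring

lemma sum_sum_erase_eq {n : ℕ} (F : Fin n → Fin n → ℝ) :
    ∑ i, ∑ j ∈ Finset.univ.erase i, F i j =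
      ∑ e : UpperPair n, (F e.1.1 e.1.2 + F e.1.2 e.1.1) := by
  have h1 : ∀ G : Fin n × Fin n → ℝ, ∑ z ∈ Finset.univ.filter (fun z : Fin n × Fin n => z.1 < z.2),
      G z = ∑ e : UpperPair n, G e.1 := fun G =>
    Finset.sum_subtype _ (by simp) G
  have h2 : ∑ z ∈ Finset.univ.filter (fun z : Fin n × Fin n => z.2 < z.1), F z.1 z.2 =
      ∑ z ∈ Finset.univ.filter (fun z : Fin n × Fin n => z.1 < z.2), F z.2 z.1 :=
    Finset.sum_nbij' Prod.swap Prod.swap (by simp) (by simp) (by simp) (by simp) (by simp)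
  rw [Finset.sum_add_distrib, ← h1 fun z => F z.1 z.2, ← h1 fun z => F z.2 z.1, ← h2,
    ← Finset.sum_union, Finset.sum_sigma']
  · refine Finset.sum_nbij' (fun z => (z.1, z.2)) (fun z => ⟨z.1, z.2⟩) ?_ ?_ (by simp) (by simp)
      (by simp)
    · rintro ⟨i, j⟩ h
      have : j ≠ i := by simpa using h
      rcases lt_or_gt_of_ne this with h | h <;> simp [h]
    · rintro ⟨i, j⟩ h
      have : i < j ∨ j < i := by simpa using h
      rcases this with h | h
      · simpa using h.ne'
      · simpa using h.ne
  · rw [Finset.disjoint_filter]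
    intro z _ h
    exact lt_asymm h

lemma edgeProb_chungLuMatrix {n : ℕ} {p c : ℝ} (hp : 0 ≤ p) (hpc : p * c ^ 2 ≤ 1) {θ : Fin n → ℝ}
    (hθ0 : ∀ v, 0 ≤ θ v) (hθ : ∀ v, θ v ≤ c) (e : UpperPair n) :
    edgeProb (chungLuMatrix p θ) e = p * θ e.1.1 * θ e.1.2 := by
  have he : chungLuMatrix p θ e.1.1 e.1.2 = p * θ e.1.1 * θ e.1.2 := by
    simp [chungLuMatrix, e.2.ne]
  rw [edgeProb_of_mem, he]
  rw [he]
  refine ⟨mul_nonneg (mul_nonneg hp (hθ0 _)) (hθ0 _), le_trans ?_ hpc⟩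
  rw [mul_assoc, sq]
  exact mul_le_mul_of_nonneg_left (mul_le_mul (hθ _) (hθ _) (hθ0 _)
    ((hθ0 e.1.1).trans (hθ _))) hp

/-- A linear statistic of the estimation errors is a linear combination of centred edge indicators
plus a bias of relative order `1 / n`. -/
lemma sum_mul_thetaHat_sub_eq {n : ℕ} (hn : 2 ≤ n) {p c : ℝ} (hp : 0 < p) (hpc : p * c ^ 2 ≤ 1)
    {θ : Fin n → ℝ} (hθ0 : ∀ v, 0 ≤ θ v) (hθ : ∀ v, θ v ≤ c) (hsum : ∑ i, θ i = n)
    (a : Fin n → ℝ) (A : SimpleGraph (Fin n)) :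
    ∑ i, a i * (thetaHat p A i - θ i) =
      edgeNoise (chungLuMatrix p θ) (fun e => a e.1.1 + a e.1.2) A / ((n - 1) * p) +
        ∑ i, a i * (θ i * (1 - θ i) / (n - 1)) := by
  classical
  have hn1 : (0 : ℝ) < n - 1 := by
    have : (2 : ℝ) ≤ n := by exact_mod_cast hn
    linarith
  have h1 : ∑ i, ∑ j ∈ Finset.univ.erase i, a i * A.adjMatrix ℝ i j =
      ∑ e : UpperPair n, (a e.1.1 + a e.1.2) * (if A.Adj e.1.1 e.1.2 then 1 else 0) := by
    rw [sum_sum_erase_eq]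
    refine Finset.sum_congr rfl fun e _ => ?_
    simp only [SimpleGraph.adjMatrix_apply, A.adj_comm e.1.2 e.1.1]
    ring
  have h2 : ∑ i, ∑ j ∈ Finset.univ.erase i, a i * (p * θ i * θ j) =
      ∑ e : UpperPair n, (a e.1.1 + a e.1.2) * edgeProb (chungLuMatrix p θ) e := by
    rw [sum_sum_erase_eq]
    refine Finset.sum_congr rfl fun e _ => ?_
    rw [edgeProb_chungLuMatrix hp.le hpc hθ0 hθ]
    ring
  have h3 : edgeNoise (chungLuMatrix p θ) (fun e => a e.1.1 + a e.1.2) A =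
      ∑ i, a i * (∑ j ∈ Finset.univ.erase i, A.adjMatrix ℝ i j - p * θ i * (n - θ i)) := by
    have hi : ∀ i, a i * (∑ j ∈ Finset.univ.erase i, A.adjMatrix ℝ i j - p * θ i * (n - θ i)) =
        ∑ j ∈ Finset.univ.erase i, a i * A.adjMatrix ℝ i j -
          ∑ j ∈ Finset.univ.erase i, a i * (p * θ i * θ j) := fun i => by
      have hi : ∑ j ∈ Finset.univ.erase i, θ j = n - θ i := by
        rw [← hsum, ← Finset.add_sum_erase _ θ (Finset.mem_univ i), add_sub_cancel_left]
      rw [← Finset.mul_sum, ← Finset.mul_sum, ← Finset.mul_sum, hi, mul_sub]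
    simp_rw [hi]
    rw [Finset.sum_sub_distrib, h1, h2]
    simp only [edgeNoise, mul_sub, Finset.sum_sub_distrib]
  rw [h3, Finset.sum_div, ← Finset.sum_add_distrib]
  refine Finset.sum_congr rfl fun i _ => ?_
  rw [thetaHat]
  convert_to a i * (1 / ((n - 1) * p) * ∑ j ∈ Finset.univ.erase i, A.adjMatrix ℝ i j - θ i) = _
  field_simp
  ring

/-! ### Moments of the estimation errors -/

lemma two_div_le_of_two_le {n : ℕ} (hn : 2 ≤ n) : (1 : ℝ) / (n - 1) ≤ 2 / n := by
  have : (2 : ℝ) ≤ n := by exact_mod_cast hn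
  rw [div_le_div_iff₀ (by linarith) (by linarith)]
  linarith

lemma abs_bias_le {n : ℕ} (hn : 2 ≤ n) {c t : ℝ} (hc : 1 ≤ c) (ht0 : 0 ≤ t) (ht : t ≤ c) :
    |t * (1 - t) / (n - 1)| ≤ 2 * c ^ 2 / n := by
  have h2 : (2 : ℝ) ≤ n := by exact_mod_cast hn
  have h1 : |t * (1 - t)| ≤ c ^ 2 := by
    rw [abs_mul, abs_of_nonneg ht0, sq]
    exact mul_le_mul ht (abs_le.2 ⟨by linarith, by linarith⟩) (abs_nonneg _) (by linarith)
  rw [abs_div, abs_of_pos (by linarith : (0 : ℝ) < n - 1)]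
  calc |t * (1 - t)| / (n - 1) = |t * (1 - t)| * (1 / (n - 1)) := by ring
    _ ≤ c ^ 2 * (2 / n) :=
      mul_le_mul h1 (two_div_le_of_two_le hn) (by have := h2; exact one_div_nonneg.2 (by linarith))
        (by positivity)
    _ = _ := by ring

/-- The linear statistics of the estimation errors with coefficients of order `B` are of order
`B / p`: the contributions of the nodes average out, as the edges are independent. -/
lemma integral_abs_sum_mul_thetaHat_sub_le {n : ℕ} (hn : 2 ≤ n) {p c : ℝ} (hp : 0 < p)
    (hp1 : p ≤ 1) (hc : 1 ≤ c) (hpc : p * c ^ 2 ≤ 1)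
    {θ : Fin n → ℝ} (hθ0 : ∀ v, 0 ≤ θ v) (hθ : ∀ v, θ v ≤ c) (hsum : ∑ i, θ i = n)
    (hnp : 1 ≤ n * p) {B : ℝ} (hB : 0 < B) {a : Fin n → ℝ} (ha : ∀ i, |a i| ≤ B) :
    ∫ A, |∑ i, a i * (thetaHat p A i - θ i)| ∂networkLaw (chungLuMatrix p θ) ≤
      26 * c ^ 2 * (B / p) := by
  have h2 : (2 : ℝ) ≤ n := by exact_mod_cast hn
  have hr0 : 0 < √p := Real.sqrt_pos.2 hp
  have hr2 : √p ^ 2 = p := Real.sq_sqrt hp.le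
  have hr1 : √p ≤ 1 := Real.sqrt_le_one.2 hp1
  set μ := networkLaw (chungLuMatrix p θ) with hμ
  set b : UpperPair n → ℝ := fun e => a e.1.1 + a e.1.2 with hb
  set N := edgeNoise (chungLuMatrix p θ) b with hN
  have hbB : ∀ e, |b e| ≤ 2 * B := fun e =>
    (abs_add_le _ _).trans (by linarith [ha e.1.1, ha e.1.2])
  -- `s ^ 2` bounds the variance of the noise, and `s ≥ 2 B` because `n √p ≥ n p ≥ 1`
  set s := 2 * B * c * (n * √p) with hs
  have hnr : 1 ≤ n * √p := hnp.trans (mul_le_mul_of_nonneg_left (by nlinarith) (by linarith))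
  have hs0 : 0 < s := by positivity
  have hexp := integral_exp_abs_edgeNoise_le (chungLuMatrix p θ) (b := b) hs0
    (fun e => (hbB e).trans ?_) ?_
  · have hNs : ∫ A, |N A| ∂μ ≤ s * (2 * Real.exp 1) := by
      refine le_trans ?_ (mul_le_mul_of_nonneg_left hexp hs0.le)
      rw [← integral_const_mul]
      refine integral_mono (integrable_networkLaw _ _) (integrable_networkLaw _ _) fun A => ?_
      have := Real.add_one_le_exp (|N A| / s)
      calc |N A| = s * (|N A| / s) := by field_simp
        _ ≤ s * Real.exp (|N A| / s) := mul_le_mul_of_nonneg_left (by linarith) hs0.le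
    have hpt : ∀ A, |∑ i, a i * (thetaHat p A i - θ i)| ≤ 2 / (n * p) * |N A| + 2 * c ^ 2 * B := by
      intro A
      rw [sum_mul_thetaHat_sub_eq hn hp hpc hθ0 hθ hsum a A]
      refine (abs_add_le _ _).trans (add_le_add ?_ ?_)
      · rw [abs_div, abs_of_pos (mul_pos (by linarith : (0 : ℝ) < n - 1) hp)]
        calc |N A| / ((n - 1) * p) = 1 / (n - 1) * (|N A| / p) := by field_simp
          _ ≤ 2 / n * (|N A| / p) :=
            mul_le_mul_of_nonneg_right (two_div_le_of_two_le hn) (by positivity)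
          _ = _ := by field_simp
      · calc _ ≤ ∑ i : Fin n, |a i * (θ i * (1 - θ i) / (n - 1))| := Finset.abs_sum_le_sum_abs _ _
          _ ≤ ∑ i : Fin n, B * (2 * c ^ 2 / n) := Finset.sum_le_sum fun i _ => by
            rw [abs_mul]
            exact mul_le_mul (ha i) (abs_bias_le hn hc (hθ0 i) (hθ i)) (abs_nonneg _) hB.le
          _ = 2 * c ^ 2 * B := by
            rw [Finset.sum_const, Finset.card_univ, Fintype.card_fin, nsmul_eq_mul]
            field_simp
    have he : Real.exp 1 ≤ 3 := Real.exp_one_lt_three.le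
    calc _ ≤ ∫ A, (2 / (n * p) * |N A| + 2 * c ^ 2 * B) ∂μ :=
          integral_mono (integrable_networkLaw _ _) (integrable_networkLaw _ _) hpt
      _ = 2 / (n * p) * ∫ A, |N A| ∂μ + 2 * c ^ 2 * B := by
          rw [integral_add (integrable_networkLaw _ _) (integrable_networkLaw _ _),
            integral_const_mul]
          simp [hμ]
      _ ≤ 2 / (n * p) * (s * (2 * 3)) + 2 * c ^ 2 * B := by
          gcongr
          exact hNs.trans (by gcongr)
      _ = 24 * c * B * √p / p + 2 * c ^ 2 * B := by rw [hs]; field_simp; ring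
      _ ≤ 24 * c ^ 2 * B * 1 / p + 2 * c ^ 2 * B / p := by
          refine add_le_add ?_ ?_
          · gcongr
            nlinarith
          · rw [le_div_iff₀ hp]
            exact mul_le_of_le_one_right (by positivity) hp1
      _ = _ := by ring
  · calc 2 * B ≤ 2 * B * (c * (n * √p)) :=
        le_mul_of_one_le_right (by positivity) (one_le_mul_of_one_le_of_one_le hc hnr)
      _ = s := by rw [hs]; ring
  · have hcard : (Fintype.card (UpperPair n) : ℝ) ≤ n * n := by
      have := Fintype.card_subtype_le fun e : Fin n × Fin n => e.1 < e.2
      rw [Fintype.card_prod, Fintype.card_fin] at this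
      exact_mod_cast this
    calc ∑ e, b e ^ 2 * edgeProb (chungLuMatrix p θ) e
        ≤ ∑ e : UpperPair n, (2 * B) ^ 2 * (p * c ^ 2) := by
          refine Finset.sum_le_sum fun e _ => ?_
          refine mul_le_mul ?_ ?_ (edgeProb_nonneg _ _) (by positivity)
          · rw [← sq_abs]
            exact pow_le_pow_left₀ (abs_nonneg _) (hbB e) 2
          · rw [edgeProb_chungLuMatrix hp.le hpc hθ0 hθ, mul_assoc, sq]
            exact mul_le_mul_of_nonneg_left (mul_le_mul (hθ _) (hθ _) (hθ0 _) (by linarith)) hp.le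
      _ = Fintype.card (UpperPair n) * ((2 * B) ^ 2 * (p * c ^ 2)) := by
          rw [Finset.sum_const, Finset.card_univ, nsmul_eq_mul]
      _ ≤ (n * n) * ((2 * B) ^ 2 * (p * c ^ 2)) :=
          mul_le_mul_of_nonneg_right hcard (by positivity)
      _ = s ^ 2 := by rw [hs, mul_pow _ (n * √p), mul_pow _ (√p), hr2]; ring

/-- The constant in the bound on the moments of the estimation errors. -/
def momentConst (c : ℝ) (k D : ℕ) : ℝ :=
  (2 * c ^ 2) ^ k * (4 * c ^ 2) ^ D * ((k + D).factorial * (Real.exp 1 * (2 * Real.exp 1)))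

lemma momentConst_nonneg (c : ℝ) (k D : ℕ) : 0 ≤ momentConst c k D := by
  unfold momentConst; positivity

/-- The estimation errors are of order `(n p)^{-1/2}`, with all moments. -/
lemma integral_abs_thetaHat_sub_pow_le {n : ℕ} (hn : 2 ≤ n) {p c : ℝ} (hp : 0 < p)
    (hp1 : p ≤ 1) (hc : 1 ≤ c) (hpc : p * c ^ 2 ≤ 1)
    {θ : Fin n → ℝ} (hθ0 : ∀ v, 0 ≤ θ v) (hθ : ∀ v, θ v ≤ c) (hsum : ∑ i, θ i = n)
    (hnp : 1 ≤ n * p) (k D : ℕ) (i : Fin n) :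
    ∫ A, |thetaHat p A i - θ i| ^ k * (1 + |thetaHat p A i - θ i|) ^ D
      ∂networkLaw (chungLuMatrix p θ) ≤ momentConst c k D / √(n * p) ^ k := by
  classical
  have h2 : (2 : ℝ) ≤ n := by exact_mod_cast hn
  set r := √(n * p) with hr
  have hr2 : r ^ 2 = n * p := Real.sq_sqrt (by positivity)
  have hr1 : 1 ≤ r := Real.one_le_sqrt.2 hnp
  have hrn : r ≤ n := by nlinarith
  set a : Fin n → ℝ := Pi.single i 1 with ha
  -- `b` is the indicator of the edges at `i`, so that the noise is the centred degree of `i`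
  set b : UpperPair n → ℝ := fun e => a e.1.1 + a e.1.2 with hb
  have hb01 : ∀ e, b e = 0 ∨ b e = 1 := by
    intro e
    simp only [hb, ha, Pi.single_apply]
    have := e.2.ne
    by_cases h1 : e.1.1 = i
    · have : e.1.2 ≠ i := fun h => this (h1.trans h.symm)
      simp [h1, this]
    · by_cases h3 : e.1.2 = i <;> simp [h1, h3]
  set N := edgeNoise (chungLuMatrix p θ) b with hN
  set s := c * r with hs
  have hs0 : 0 < s := by positivity
  have hexp := integral_exp_abs_edgeNoise_le (chungLuMatrix p θ) (b := b) hs0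
    (fun e => ?_) ?_
  · have hpt : ∀ A, |thetaHat p A i - θ i| ≤ 2 * c ^ 2 * (|N A| / s + 1) / r := by
      intro A
      have h := sum_mul_thetaHat_sub_eq hn hp hpc hθ0 hθ hsum a A
      simp only [ha, Pi.single_apply, ite_mul, one_mul, zero_mul, Finset.sum_ite_eq',
        Finset.mem_univ, if_true] at h
      have h' : thetaHat p A i - θ i = N A / ((n - 1) * p) + θ i * (1 - θ i) / (n - 1) := by
        rw [h, hN, hb]
        simp only [ha, Pi.single_apply]
      rw [h']
      have e1 : |N A / ((n - 1) * p)| ≤ 2 * c ^ 2 * (|N A| / s) / r := by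
        rw [abs_div, abs_of_pos (mul_pos (by linarith : (0 : ℝ) < n - 1) hp)]
        calc |N A| / ((n - 1) * p) = 1 / (n - 1) * (|N A| / p) := by field_simp
          _ ≤ 2 / n * (|N A| / p) :=
            mul_le_mul_of_nonneg_right (two_div_le_of_two_le hn) (by positivity)
          _ = 2 * |N A| / r ^ 2 := by rw [hr2]; field_simp
          _ = 2 * c * (|N A| / s) / r := by rw [hs]; field_simp
          _ ≤ _ := by
            gcongr
            nlinarith
      have e2 : |θ i * (1 - θ i) / (n - 1)| ≤ 2 * c ^ 2 * 1 / r := by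
        refine (abs_bias_le hn hc (hθ0 i) (hθ i)).trans ?_
        rw [mul_one]
        gcongr
      calc _ ≤ _ := abs_add_le _ _
        _ ≤ _ := add_le_add e1 e2
        _ = _ := by ring
    have hpt2 : ∀ A, |thetaHat p A i - θ i| ^ k * (1 + |thetaHat p A i - θ i|) ^ D ≤
        (2 * c ^ 2) ^ k * (4 * c ^ 2) ^ D * ((k + D).factorial * Real.exp 1) / r ^ k *
          Real.exp (|N A| / s) := by
      intro A
      set d := |thetaHat p A i - θ i| with hd
      set z := |N A| / s with hz
      have hz0 : 0 ≤ z := by positivity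
      have hd0 : 0 ≤ d := abs_nonneg _
      have hdz : d ≤ 2 * c ^ 2 * (z + 1) / r := hpt A
      have hdz' : 1 + d ≤ 4 * c ^ 2 * (z + 1) := by
        have h3 : 2 * c ^ 2 * (z + 1) / r ≤ 2 * c ^ 2 * (z + 1) :=
          div_le_self (by positivity) hr1
        nlinarith
      have hfac : (z + 1) ^ (k + D) ≤ (k + D).factorial * Real.exp (z + 1) := by
        have := Real.pow_div_factorial_le_exp (z + 1) (by linarith) (k + D)
        rwa [div_le_iff₀ (by positivity), mul_comm] at this
      calc d ^ k * (1 + d) ^ D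
          ≤ (2 * c ^ 2 * (z + 1) / r) ^ k * (4 * c ^ 2 * (z + 1)) ^ D :=
            mul_le_mul (pow_le_pow_left₀ hd0 hdz _) (pow_le_pow_left₀ (by positivity) hdz' _)
              (by positivity) (by positivity)
        _ = (2 * c ^ 2) ^ k * (4 * c ^ 2) ^ D / r ^ k * (z + 1) ^ (k + D) := by
            rw [div_pow, mul_pow (2 * c ^ 2), mul_pow (4 * c ^ 2), pow_add]; ring
        _ ≤ (2 * c ^ 2) ^ k * (4 * c ^ 2) ^ D / r ^ k *
              ((k + D).factorial * Real.exp (z + 1)) :=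
            mul_le_mul_of_nonneg_left hfac (by positivity)
        _ = _ := by rw [Real.exp_add]; ring
    calc _ ≤ ∫ A, (2 * c ^ 2) ^ k * (4 * c ^ 2) ^ D * ((k + D).factorial * Real.exp 1) / r ^ k *
          Real.exp (|N A| / s) ∂networkLaw (chungLuMatrix p θ) :=
          integral_mono (integrable_networkLaw _ _) (integrable_networkLaw _ _) hpt2
      _ ≤ (2 * c ^ 2) ^ k * (4 * c ^ 2) ^ D * ((k + D).factorial * Real.exp 1) / r ^ k *
          (2 * Real.exp 1) := by
          rw [integral_const_mul]
          exact mul_le_mul_of_nonneg_left hexp (by positivity)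
      _ = _ := by rw [momentConst]; ring
  · have h1s : 1 ≤ s := one_le_mul_of_one_le_of_one_le hc hr1
    rcases hb01 e with h | h <;> rw [h] <;> simp <;> linarith
  · -- the expected degree of `i` is at most `c ^ 2 n p`
    have hsq : ∀ e, b e ^ 2 = b e := fun e => by rcases hb01 e with h | h <;> simp [h]
    calc ∑ e, b e ^ 2 * edgeProb (chungLuMatrix p θ) e
        = ∑ e, b e * edgeProb (chungLuMatrix p θ) e := by simp_rw [hsq]
      _ = ∑ i, ∑ j ∈ Finset.univ.erase i, a i * (p * θ i * θ j) := by
          rw [sum_sum_erase_eq]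
          refine Finset.sum_congr rfl fun e _ => ?_
          rw [edgeProb_chungLuMatrix hp.le hpc hθ0 hθ]
          ring
      _ = ∑ j ∈ Finset.univ.erase i, p * θ i * θ j := by
          simp only [ha, Pi.single_apply, ite_mul, one_mul, zero_mul]
          rw [Finset.sum_eq_single i (fun j _ hj => by simp [hj]) (by simp)]
          simp
      _ ≤ ∑ j : Fin n, p * c ^ 2 := by
          refine (Finset.sum_le_univ_sum_of_nonneg fun j =>
            mul_nonneg (mul_nonneg hp.le (hθ0 _)) (hθ0 _)).trans (Finset.sum_le_sum fun j _ => ?_)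
          rw [mul_assoc, sq]
          exact mul_le_mul_of_nonneg_left (mul_le_mul (hθ _) (hθ _) (hθ0 _) (by linarith)) hp.le
      _ = s ^ 2 := by
          rw [Finset.sum_const, Finset.card_univ, Fintype.card_fin, nsmul_eq_mul, hs, mul_pow, hr2]
          ring

/-! ### Subgraph counts as sums over images -/

open Classical in
/-- The images `R.map f` of `R` under the injections `f` of its nodes into `{0, …, n-1}` that
satisfy `φ`. -/
def embeddedCopies {W : Type*} [Fintype W] (R : SimpleGraph W) {n : ℕ} (φ : (W ↪ Fin n) → Prop) :
    Finset (SimpleGraph (Fin n)) :=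
  (Finset.univ.filter φ).image fun f => R.map f

lemma mem_embeddedCopies {W : Type*} [Fintype W] {R : SimpleGraph W} {n : ℕ}
    {φ : (W ↪ Fin n) → Prop} {K : SimpleGraph (Fin n)} :
    K ∈ embeddedCopies R φ ↔ ∃ f : W ↪ Fin n, φ f ∧ R.map f = K := by
  simp [embeddedCopies]

lemma card_edgePairs_of_mem_embeddedCopies {W : Type*} [Fintype W] {R : SimpleGraph W} {n : ℕ}
    {φ : (W ↪ Fin n) → Prop} {K : SimpleGraph (Fin n)} (hK : K ∈ embeddedCopies R φ) :
    (edgePairs K).card = R.edgeSet.ncard := by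
  obtain ⟨f, _, rfl⟩ := mem_embeddedCopies.1 hK
  exact card_edgePairs_map R f

lemma exists_adj_of_connected {W : Type*} [Fintype W] {R : SimpleGraph W} (hR : R.Connected)
    (hv : 2 ≤ Fintype.card W) (w : W) : ∃ u, R.Adj w u := by
  classical
  have : Nontrivial W := Fintype.one_lt_card_iff_nontrivial.1 hv
  have := hR.preconnected.degree_pos_of_nontrivial w
  exact (SimpleGraph.degree_pos_iff_exists_adj _ _).1 this

/-- The injection of the nodes of `R` that underlies an isomorphism to a subgraph. -/
def isoEmbedding {W V : Type*} {R : SimpleGraph W} {A : SimpleGraph V} {G : A.Subgraph}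
    (f : R ≃g G.coe) : W ↪ V :=
  f.toEquiv.toEmbedding.trans (Function.Embedding.subtype _)

open Classical in
/-- A subgraph that is isomorphic to a connected graph with an edge is determined by its edges, so
that counting subgraphs amounts to counting the images of `R` that are contained in `A`. -/
lemma ncard_subgraph_eq_sum {W : Type*} [Fintype W] {R : SimpleGraph W} (hR : R.Connected)
    (hv : 2 ≤ Fintype.card W) {n : ℕ} (φ : (W ↪ Fin n) → Prop) (A : SimpleGraph (Fin n)) :
    ({G : A.Subgraph | ∃ f : R ≃g G.coe, φ (isoEmbedding f)}.ncard : ℝ) =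
      ∑ K ∈ embeddedCopies R φ, if K ≤ A then (1 : ℝ) else 0 := by
  set S := {G : A.Subgraph | ∃ f : R ≃g G.coe, φ (isoEmbedding f)} with hS
  -- no node of the subgraph is isolated
  have hverts : ∀ G ∈ S, ∀ v, v ∈ G.verts ↔ ∃ u, G.Adj v u := by
    rintro G ⟨f, _⟩ v
    refine ⟨fun h => ?_, fun ⟨u, hu⟩ => hu.fst_mem⟩
    obtain ⟨u, hu⟩ := exists_adj_of_connected hR hv (f.symm ⟨v, h⟩)
    refine ⟨f u, ?_⟩
    have := f.map_adj_iff.2 hu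
    simpa using this
  have hinj : Set.InjOn (fun G : A.Subgraph => G.spanningCoe) S := by
    intro G hG G' hG' h
    have hadj : G.Adj = G'.Adj := congrArg SimpleGraph.Adj h
    refine SimpleGraph.Subgraph.ext ?_ hadj
    ext v
    rw [hverts G hG, hverts G' hG', hadj]
  have himage : (fun G : A.Subgraph => G.spanningCoe) '' S =
      ↑((embeddedCopies R φ).filter fun K => K ≤ A) := by
    ext K
    simp only [Set.mem_image, Finset.coe_filter, Set.mem_ofPred_eq, mem_embeddedCopies]
    constructor
    · rintro ⟨G, ⟨f, hf⟩, rfl⟩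
      refine ⟨⟨isoEmbedding f, hf, ?_⟩, G.spanningCoe_le⟩
      ext a b
      rw [SimpleGraph.map_adj, SimpleGraph.Subgraph.spanningCoe_adj]
      constructor
      · rintro ⟨u, v, huv, rfl, rfl⟩
        exact f.map_adj_iff.2 huv
      · intro h
        refine ⟨f.symm ⟨a, h.fst_mem⟩, f.symm ⟨b, h.snd_mem⟩, ?_, ?_, ?_⟩
        · rw [f.symm.map_adj_iff]
          exact h
        · exact congrArg Subtype.val (f.apply_symm_apply ⟨a, h.fst_mem⟩)
        · exact congrArg Subtype.val (f.apply_symm_apply ⟨b, h.snd_mem⟩)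
    · rintro ⟨⟨f, hf, rfl⟩, hle⟩
      let G : A.Subgraph :=
        { verts := Set.range f
          Adj := (R.map f).Adj
          adj_sub := fun h => hle h
          edge_vert := fun h => by
            obtain ⟨u, _, _, rfl, _⟩ := (SimpleGraph.map_adj f R _ _).1 h
            exact ⟨u, rfl⟩
          symm := (R.map f).symm }
      let g : R ≃g G.coe :=
        { toEquiv := Equiv.ofInjective f f.injective
          map_rel_iff' := SimpleGraph.map_adj_apply }
      have hg : isoEmbedding g = f := by ext w; rfl
      exact ⟨G, ⟨g, by rwa [hg]⟩, rfl⟩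
  rw [← hinj.ncard_image, himage, Set.ncard_coe_finset, Finset.sum_boole]

open Classical in
lemma globalCount_eq_sum {W : Type*} [Fintype W] {R : SimpleGraph W} (hR : R.Connected)
    (hv : 2 ≤ Fintype.card W) {n : ℕ} (A : SimpleGraph (Fin n)) :
    globalCount R A =
      ∑ K ∈ embeddedCopies R (fun _ : W ↪ Fin n => True), if K ≤ A then (1 : ℝ) else 0 := by
  rw [← ncard_subgraph_eq_sum hR hv, globalCount, SimpleGraph.copyCount,
    ← Set.ncard_coe_finset]
  congr 2
  ext G
  simp only [Finset.coe_filter, Finset.mem_univ, true_and, Set.mem_ofPred_eq]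
  exact ⟨fun ⟨f⟩ => ⟨f, trivial⟩, fun ⟨f, _⟩ => ⟨f⟩⟩

open Classical in
lemma rootedCount_eq_sum {W : Type*} [Fintype W] {R : SimpleGraph W} (hR : R.Connected)
    (hv : 2 ≤ Fintype.card W) (r : W) {n : ℕ} (i : Fin n) (A : SimpleGraph (Fin n)) :
    rootedCount R r i A =
      ∑ K ∈ embeddedCopies R (fun f : W ↪ Fin n => f r = i), if K ≤ A then (1 : ℝ) else 0 :=
  ncard_subgraph_eq_sum hR hv (fun f : W ↪ Fin n => f r = i) A

lemma embeddedCopies_nonempty {W : Type*} [Fintype W] (R : SimpleGraph W) {n : ℕ}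
    (hn : Fintype.card W ≤ n) : (embeddedCopies R (fun _ : W ↪ Fin n => True)).Nonempty := by
  obtain ⟨f⟩ := Function.Embedding.nonempty_of_card_le (α := W) (β := Fin n) (by simpa using hn)
  exact ⟨R.map f, mem_embeddedCopies.2 ⟨f, trivial, rfl⟩⟩

lemma embeddedCopies_rooted_nonempty {W : Type*} [Fintype W] (R : SimpleGraph W) (r : W) {n : ℕ}
    (hn : Fintype.card W ≤ n) (i : Fin n) :
    (embeddedCopies R (fun f : W ↪ Fin n => f r = i)).Nonempty := by
  obtain ⟨f⟩ := Function.Embedding.nonempty_of_card_le (α := W) (β := Fin n) (by simpa using hn)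
  exact ⟨_, mem_embeddedCopies.2
    ⟨f.trans (Equiv.swap (f r) i).toEmbedding, Equiv.swap_apply_left (f r) i, rfl⟩⟩

lemma map_swap_mem_embeddedCopies {W : Type*} [Fintype W] {R : SimpleGraph W} {n : ℕ}
    (i j : Fin n) {K : SimpleGraph (Fin n)}
    (hK : K ∈ embeddedCopies R (fun _ : W ↪ Fin n => True)) :
    K.map (Equiv.swap i j) ∈ embeddedCopies R (fun _ : W ↪ Fin n => True) := by
  obtain ⟨f, _, rfl⟩ := mem_embeddedCopies.1 hK
  refine mem_embeddedCopies.2 ⟨f.trans (Equiv.swap i j).toEmbedding, trivial, ?_⟩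
  rw [SimpleGraph.map_map]
  rfl

lemma edgeSet_ncard_pos {W : Type*} [Fintype W] {R : SimpleGraph W} (hR : R.Connected)
    (hv : 2 ≤ Fintype.card W) : 0 < R.edgeSet.ncard := by
  obtain ⟨w⟩ := hR.nonempty
  obtain ⟨u, hu⟩ := exists_adj_of_connected hR hv w
  exact (Set.ncard_pos).2 ⟨s(w, u), hu⟩

/-! ### Deviation bounds and rates in probability -/

/-- The conditions on the parameters of the Chung-Lu model under which the bounds below hold for a
fixed number `n` of nodes, with constants that depend on `c₀` and `c` only. In the asymptotic regime
they hold for all large `n`. -/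
structure IsChungLuParam {n : ℕ} (p c₀ c : ℝ) (θ : Fin n → ℝ) : Prop where
  two_le : 2 ≤ n
  p_pos : 0 < p
  one_le : 1 ≤ n * p
  c₀_pos : 0 < c₀
  c₀_le : c₀ ≤ 1
  one_le_c : 1 ≤ c
  p_mul_le : p * c ^ 2 ≤ 1 / 4
  le_θ : ∀ v, c₀ ≤ θ v
  θ_le : ∀ v, θ v ≤ c
  sum_θ : ∑ i, θ i = n

namespace IsChungLuParam

variable {n : ℕ} {p c₀ c : ℝ} {θ : Fin n → ℝ}

lemma p_le_one (h : IsChungLuParam p c₀ c θ) : p ≤ 1 := by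
  have h1 := h.p_mul_le
  have h2 : 1 ≤ c ^ 2 := one_le_pow₀ h.one_le_c
  nlinarith [h.p_pos]

lemma p_mul_le_one (h : IsChungLuParam p c₀ c θ) : p * c ^ 2 ≤ 1 :=
  h.p_mul_le.trans (by norm_num)

lemma θ_nonneg (h : IsChungLuParam p c₀ c θ) (v : Fin n) : 0 ≤ θ v := h.c₀_pos.le.trans (h.le_θ v)

lemma mul_mem (h : IsChungLuParam p c₀ c θ) (i j : Fin n) :
    0 ≤ p * θ i * θ j ∧ p * θ i * θ j ≤ 1 := by
  refine ⟨mul_nonneg (mul_nonneg h.p_pos.le (h.θ_nonneg _)) (h.θ_nonneg _), ?_⟩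
  refine le_trans ?_ h.p_mul_le_one
  rw [mul_assoc, sq]
  exact mul_le_mul_of_nonneg_left (mul_le_mul (h.θ_le _) (h.θ_le _) (h.θ_nonneg _)
    (by linarith [h.one_le_c])) h.p_pos.le

end IsChungLuParam

lemma thetaHat_nonneg {n : ℕ} (hn : 2 ≤ n) {p : ℝ} (hp : 0 < p) (A : SimpleGraph (Fin n))
    (i : Fin n) : 0 ≤ thetaHat p A i := by
  classical
  have hn1 : (0 : ℝ) < n - 1 := by
    have : (2 : ℝ) ≤ n := by exact_mod_cast hn
    linarith
  rw [thetaHat]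
  refine mul_nonneg (by positivity) (Finset.sum_nonneg fun j _ => ?_)
  rw [SimpleGraph.adjMatrix_apply]
  split_ifs <;> norm_num

/-- If all estimation errors are moderate, then the estimated edge probabilities lie in `[0, 1]`. -/
lemma thetaHat_mul_mem {n : ℕ} {p c₀ c : ℝ} {θ : Fin n → ℝ} (h : IsChungLuParam p c₀ c θ)
    {A : SimpleGraph (Fin n)}
    (hA : ∑ i, |thetaHat p A i - θ i| ^ 4 < 1 / (16 * p ^ 2)) (i j : Fin n) :
    0 ≤ p * thetaHat p A i * thetaHat p A j ∧ p * thetaHat p A i * thetaHat p A j ≤ 1 := by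
  have hp := h.p_pos
  have hx0 := thetaHat_nonneg h.two_le hp A
  -- it suffices that `√p θ̂ i ≤ 1` for all `i`, where `√p θ i ≤ 1 / 2`
  have hr2 : √p * √p = p := Real.mul_self_sqrt hp.le
  have hr0 : 0 < √p := Real.sqrt_pos.2 hp
  have hrc : √p * c ≤ 1 / 2 := by
    refine le_of_pow_le_pow_left₀ two_ne_zero (by norm_num) ?_
    rw [mul_pow, Real.sq_sqrt hp.le]
    linarith [h.p_mul_le]
  have hx1 : ∀ i, √p * thetaHat p A i ≤ 1 := by
    intro i
    have h1 : |thetaHat p A i - θ i| ^ 4 < 1 / (16 * p ^ 2) :=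
      (Finset.single_le_sum (f := fun i => |thetaHat p A i - θ i| ^ 4)
        (fun i _ => by positivity) (Finset.mem_univ i)).trans_lt hA
    have h2 : √p * |thetaHat p A i - θ i| ≤ 1 / 2 := by
      refine (lt_of_pow_lt_pow_left₀ 4 (by norm_num) ?_).le
      have h4 : √p ^ 4 = p ^ 2 := by
        rw [show (4 : ℕ) = 2 * 2 from rfl, pow_mul, Real.sq_sqrt hp.le]
      rw [mul_pow, h4]
      rw [lt_div_iff₀ (by positivity)] at h1
      linarith
    have h3 := le_abs_self (thetaHat p A i - θ i)
    have h4 := h.θ_le i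
    nlinarith
  refine ⟨mul_nonneg (mul_nonneg hp.le (hx0 i)) (hx0 j), ?_⟩
  calc p * thetaHat p A i * thetaHat p A j
      = (√p * thetaHat p A i) * (√p * thetaHat p A j) := by
        linear_combination -(thetaHat p A i * thetaHat p A j) * hr2
    _ ≤ 1 := mul_le_one₀ (hx1 i) (mul_nonneg hr0.le (hx0 j)) (hx1 j)

/-- Markov's inequality for a variable `f` that is bounded by `Y` unless `Z` is large. -/
lemma networkLaw_lt_le_of_integral_le {n : ℕ} (Q : Matrix (Fin n) (Fin n) ℝ)
    {f Y Z : SimpleGraph (Fin n) → ℝ} {z a α β : ℝ} (hz : 0 < z) (ha : 0 < a)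
    (hY : ∀ A, 0 ≤ Y A) (hZ : ∀ A, 0 ≤ Z A) (hf : ∀ A, Z A < z → f A ≤ Y A)
    (hIY : ∫ A, Y A ∂networkLaw Q ≤ β) (hIZ : ∫ A, Z A ∂networkLaw Q ≤ α) :
    networkLaw Q {A | a < f A} ≤ ENNReal.ofReal (α / z + β / a) := by
  have hmarkov : ∀ (g : SimpleGraph (Fin n) → ℝ) (t γ : ℝ), 0 < t → (∀ A, 0 ≤ g A) →
      ∫ A, g A ∂networkLaw Q ≤ γ → (networkLaw Q).real {A | t ≤ g A} ≤ γ / t := by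
    intro g t γ ht hg hI
    rw [le_div_iff₀ ht, mul_comm]
    exact (mul_meas_ge_le_integral_of_nonneg (Eventually.of_forall hg)
      (integrable_networkLaw Q g) t).trans hI
  rw [← ofReal_measureReal]
  refine ENNReal.ofReal_le_ofReal ?_
  calc (networkLaw Q).real {A | a < f A}
      ≤ (networkLaw Q).real ({A | z ≤ Z A} ∪ {A | a ≤ Y A}) := by
        refine measureReal_mono fun A hA => ?_
        by_cases h : z ≤ Z A
        · exact Or.inl h
        · exact Or.inr (hA.le.trans (hf A (not_le.1 h)))
    _ ≤ _ := measureReal_union_le _ _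
    _ ≤ _ := add_le_add (hmarkov Z z α hz hZ hIZ) (hmarkov Y a β ha hY hIY)

/-- Deviation bound for the relative error when, apart from the event that an estimated edge
probability exceeds `1`, it is bounded by a variable with mean at most `β`. -/
lemma relVarError_tail_le {n : ℕ} {p c₀ c : ℝ} {θ : Fin n → ℝ} (h : IsChungLuParam p c₀ c θ)
    {T : SimpleGraph (Fin n) → ℝ} {Y : SimpleGraph (Fin n) → ℝ} (hY : ∀ A, 0 ≤ Y A)
    (hf : ∀ A, (∀ i j, 0 ≤ p * thetaHat p A i * thetaHat p A j ∧
      p * thetaHat p A i * thetaHat p A j ≤ 1) → |relVarError p θ T A| ≤ Y A)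
    {β a : ℝ} (hIY : ∫ A, Y A ∂networkLaw (chungLuMatrix p θ) ≤ β) (ha : 0 < a) :
    networkLaw (chungLuMatrix p θ) {A | a < |relVarError p θ T A|} ≤
      ENNReal.ofReal (16 * momentConst c 4 0 / n + β / a) := by
  have hp := h.p_pos
  have hn : (0 : ℝ) < n := by
    have : (2 : ℝ) ≤ n := by exact_mod_cast h.two_le
    linarith
  have hZ : ∫ A, ∑ i, |thetaHat p A i - θ i| ^ 4 ∂networkLaw (chungLuMatrix p θ) ≤
      n * (momentConst c 4 0 / √(n * p) ^ 4) := by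
    rw [integral_finsetSum _ fun i _ => integrable_networkLaw _ _]
    calc _ ≤ ∑ i : Fin n, momentConst c 4 0 / √(n * p) ^ 4 := Finset.sum_le_sum fun i _ => by
          simpa using integral_abs_thetaHat_sub_pow_le h.two_le hp h.p_le_one h.one_le_c
            h.p_mul_le_one h.θ_nonneg h.θ_le h.sum_θ h.one_le 4 0 i
      _ = _ := by simp
  refine (networkLaw_lt_le_of_integral_le _ (z := 1 / (16 * p ^ 2)) (by positivity) ha hY
    (fun A => Finset.sum_nonneg fun i _ => by positivity)
    (fun A hA => hf A (thetaHat_mul_mem h hA)) hIY hZ).trans (le_of_eq ?_)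
  have h4 : √(n * p) ^ 4 = (n * p) ^ 2 := by
    rw [show (4 : ℕ) = 2 * 2 from rfl, pow_mul, Real.sq_sqrt (by positivity)]
  rw [h4]
  congr 2
  field_simp

/-- The constant in the Taylor expansion of the variance of a count of graphs with `m` edges. -/
def taylorConst (c : ℝ) (m : ℕ) : ℝ := 2 * ((((4 * m : ℕ) : ℝ) + 1) * (2 * c) ^ (4 * m))

lemma taylorConst_nonneg {c : ℝ} (hc : 1 ≤ c) (m : ℕ) : 0 ≤ taylorConst c m := by
  unfold taylorConst; positivity

section Bounds

variable {n : ℕ} {p c₀ c : ℝ} {θ : Fin n → ℝ} {𝓚 : Finset (SimpleGraph (Fin n))} {m : ℕ}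
  {T : SimpleGraph (Fin n) → ℝ}

open Classical in
lemma totalWeight_le_netVar (h : IsChungLuParam p c₀ c θ)
    (hm : ∀ K ∈ 𝓚, (edgePairs K).card = m)
    (hT : ∀ A, T A = ∑ K ∈ 𝓚, if K ≤ A then (1 : ℝ) else 0) :
    c₀ ^ (4 * m) / 2 * totalWeight p 𝓚 ≤ netVar (chungLuMatrix p θ) T := by
  rw [netVar_chungLuMatrix_eq h.mul_mem hT]
  exact totalWeight_le_countVar h.p_pos.le (h.p_mul_le.trans (by norm_num)) h.c₀_pos h.c₀_le
    h.le_θ h.θ_le fun K hK => (hm K hK).le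

open Classical in
lemma netVar_pos (h : IsChungLuParam p c₀ c θ) (h𝓚 : 𝓚.Nonempty) (hm0 : 0 < m)
    (hm : ∀ K ∈ 𝓚, (edgePairs K).card = m)
    (hT : ∀ A, T A = ∑ K ∈ 𝓚, if K ≤ A then (1 : ℝ) else 0) :
    0 < netVar (chungLuMatrix p θ) T := by
  refine lt_of_lt_of_le ?_ (totalWeight_le_netVar h hm hT)
  have := h.c₀_pos
  have := totalWeight_pos h.p_pos h𝓚 fun K hK => by rw [hm K hK]; exact hm0
  positivity

/-- The weighted mean of the error moments. -/
lemma integral_sum_nodeWeight_mul_le (h : IsChungLuParam p c₀ c θ)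
    (hm : ∀ K ∈ 𝓚, (edgePairs K).card = m) (k D : ℕ) :
    ∫ A, ∑ v, nodeWeight p 𝓚 v * (|thetaHat p A v - θ v| ^ k * (1 + |thetaHat p A v - θ v|) ^ D)
      ∂networkLaw (chungLuMatrix p θ) ≤
    4 * m * totalWeight p 𝓚 * (momentConst c k D / √(n * p) ^ k) := by
  rw [integral_finsetSum _ fun i _ => integrable_networkLaw _ _]
  have hM := momentConst_nonneg c k D
  calc _ ≤ ∑ v, nodeWeight p 𝓚 v * (momentConst c k D / √(n * p) ^ k) := by
        refine Finset.sum_le_sum fun v _ => ?_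
        rw [integral_const_mul]
        exact mul_le_mul_of_nonneg_left (integral_abs_thetaHat_sub_pow_le h.two_le h.p_pos
          h.p_le_one h.one_le_c h.p_mul_le_one h.θ_nonneg h.θ_le h.sum_θ h.one_le k D v)
          (nodeWeight_nonneg h.p_pos.le 𝓚 v)
    _ = (∑ v, nodeWeight p 𝓚 v) * (momentConst c k D / √(n * p) ^ k) := by rw [Finset.sum_mul]
    _ ≤ _ := mul_le_mul_of_nonneg_right
        (sum_nodeWeight_le h.p_pos.le fun K hK => (hm K hK).le) (by positivity)

/-- The constant in the deviation bound to first order. -/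
def firstOrderConst (c₀ c : ℝ) (m : ℕ) : ℝ :=
  4 * m * taylorConst c m / (c₀ ^ (4 * m) / 2) * momentConst c 1 (4 * m)

/-- The constant in the deviation bound to second order. -/
def secondOrderConst (c₀ c : ℝ) (m : ℕ) : ℝ :=
  4 * m * taylorConst c m / (c₀ ^ (4 * m) / 2) * (26 * c ^ 2 + momentConst c 2 (4 * m))

open Classical in
/-- Deviation bound for an arbitrary count, from the Taylor expansion to first order. -/
lemma relVarError_tail_le_first_order (h : IsChungLuParam p c₀ c θ) (h𝓚 : 𝓚.Nonempty)
    (hm0 : 0 < m) (hm : ∀ K ∈ 𝓚, (edgePairs K).card = m)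
    (hT : ∀ A, T A = ∑ K ∈ 𝓚, if K ≤ A then (1 : ℝ) else 0) {a : ℝ} (ha : 0 < a) :
    networkLaw (chungLuMatrix p θ) {A | a < |relVarError p θ T A|} ≤
      ENNReal.ofReal (16 * momentConst c 4 0 / n +
        firstOrderConst c₀ c m * (1 / √(n * p)) / a) := by
  have hp := h.p_pos
  have hc₀ := h.c₀_pos
  have hW : 0 < totalWeight p 𝓚 := totalWeight_pos hp h𝓚 fun K hK => by rw [hm K hK]; exact hm0
  have hC := taylorConst_nonneg h.one_le_c m
  have hVW := totalWeight_le_netVar h hm hT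
  have hV := netVar_pos h h𝓚 hm0 hm hT
  obtain ⟨_, _, hx⟩ := exists_linear_approx_countVar hp.le h.p_le_one h.one_le_c (θ := θ)
    (fun v => by rw [abs_of_nonneg (h.θ_nonneg v)]; exact h.θ_le v) (fun K hK => (hm K hK).le)
    (D := 4 * m) rfl (C := taylorConst c m) rfl
  set κW := c₀ ^ (4 * m) / 2 * totalWeight p 𝓚 with hκW
  have hκW0 : 0 < κW := by positivity
  have hW0 := nodeWeight_nonneg hp.le 𝓚
  refine relVarError_tail_le h (Y := fun A => κW⁻¹ * (taylorConst c m * ∑ v, nodeWeight p 𝓚 v *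
    (|thetaHat p A v - θ v| ^ 1 * (1 + |thetaHat p A v - θ v|) ^ (4 * m)))) ?_ ?_ ?_ ha
  · intro A
    have : 0 ≤ ∑ v, nodeWeight p 𝓚 v *
      (|thetaHat p A v - θ v| ^ 1 * (1 + |thetaHat p A v - θ v|) ^ (4 * m)) :=
      Finset.sum_nonneg fun v _ => mul_nonneg (hW0 v) (by positivity)
    exact mul_nonneg (inv_nonneg.2 hκW0.le) (mul_nonneg hC this)
  · intro A hA
    rw [relVarError, pHat, abs_div, abs_of_pos hV, netVar_chungLuMatrix_eq hA hT,
      netVar_chungLuMatrix_eq h.mul_mem hT]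
    rw [netVar_chungLuMatrix_eq h.mul_mem hT] at hVW hV
    rw [div_eq_inv_mul]
    have := (hx (thetaHat p A)).1
    simp only [pow_one]
    exact mul_le_mul (inv_anti₀ hκW0 hVW) this (abs_nonneg _) (by positivity)
  · rw [integral_const_mul, integral_const_mul]
    calc _ ≤ κW⁻¹ * (taylorConst c m *
          (4 * m * totalWeight p 𝓚 * (momentConst c 1 (4 * m) / √(n * p) ^ 1))) := by
          gcongr
          exact integral_sum_nodeWeight_mul_le h hm 1 (4 * m)
      _ = _ := by
          rw [firstOrderConst, hκW, pow_one]
          field_simp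

open Classical in
/-- Deviation bound for a count that treats all nodes alike: in the Taylor expansion to second order
the linear term averages out. -/
lemma relVarError_tail_le_second_order (h : IsChungLuParam p c₀ c θ) (h𝓚 : 𝓚.Nonempty)
    (hm0 : 0 < m) (hm : ∀ K ∈ 𝓚, (edgePairs K).card = m)
    (hswap : ∀ i j, ∀ K ∈ 𝓚, K.map (Equiv.swap i j) ∈ 𝓚)
    (hT : ∀ A, T A = ∑ K ∈ 𝓚, if K ≤ A then (1 : ℝ) else 0) {a : ℝ} (ha : 0 < a) :
    networkLaw (chungLuMatrix p θ) {A | a < |relVarError p θ T A|} ≤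
      ENNReal.ofReal (16 * momentConst c 4 0 / n +
        secondOrderConst c₀ c m * (1 / (n * p)) / a) := by
  have hp := h.p_pos
  have hc₀ := h.c₀_pos
  have hc := h.one_le_c
  have hn : (0 : ℝ) < n := by
    have : (2 : ℝ) ≤ n := by exact_mod_cast h.two_le
    linarith
  have hm0' : (0 : ℝ) < m := by exact_mod_cast hm0
  have hW : 0 < totalWeight p 𝓚 := totalWeight_pos hp h𝓚 fun K hK => by rw [hm K hK]; exact hm0
  have hC : 0 < taylorConst c m := by unfold taylorConst; positivity
  have hVW := totalWeight_le_netVar h hm hT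
  have hV := netVar_pos h h𝓚 hm0 hm hT
  obtain ⟨b, hb, hx⟩ := exists_linear_approx_countVar hp.le h.p_le_one h.one_le_c (θ := θ)
    (fun v => by rw [abs_of_nonneg (h.θ_nonneg v)]; exact h.θ_le v) (fun K hK => (hm K hK).le)
    (D := 4 * m) rfl (C := taylorConst c m) rfl
  set κW := c₀ ^ (4 * m) / 2 * totalWeight p 𝓚 with hκW
  have hκW0 : 0 < κW := by positivity
  have hW0 := nodeWeight_nonneg hp.le 𝓚
  set B := taylorConst c m * (4 * m * totalWeight p 𝓚 / n) with hB
  have hB0 : 0 < B := by positivity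
  -- by symmetry no node carries more than its share of the weight
  have hbB : ∀ i, |b i| ≤ B := fun i => (hb i).trans <| mul_le_mul_of_nonneg_left
    (by
      rw [le_div_iff₀ hn, mul_comm]
      exact card_mul_nodeWeight_le hp.le (fun K hK => (hm K hK).le) hswap i) hC.le
  refine relVarError_tail_le h (Y := fun A => κW⁻¹ * (|∑ i, b i * (thetaHat p A i - θ i)| +
    taylorConst c m * ∑ v, nodeWeight p 𝓚 v *
      (|thetaHat p A v - θ v| ^ 2 * (1 + |thetaHat p A v - θ v|) ^ (4 * m)))) ?_ ?_ ?_ ha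
  · intro A
    have : 0 ≤ ∑ v, nodeWeight p 𝓚 v *
      (|thetaHat p A v - θ v| ^ 2 * (1 + |thetaHat p A v - θ v|) ^ (4 * m)) :=
      Finset.sum_nonneg fun v _ => mul_nonneg (hW0 v) (by positivity)
    exact mul_nonneg (inv_nonneg.2 hκW0.le)
      (add_nonneg (abs_nonneg _) (mul_nonneg hC.le this))
  · intro A hA
    rw [relVarError, pHat, abs_div, abs_of_pos hV, netVar_chungLuMatrix_eq hA hT,
      netVar_chungLuMatrix_eq h.mul_mem hT]
    rw [netVar_chungLuMatrix_eq h.mul_mem hT] at hVW hV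
    rw [div_eq_inv_mul]
    refine mul_le_mul (inv_anti₀ hκW0 hVW) ?_ (abs_nonneg _) (by positivity)
    have h2 := (hx (thetaHat p A)).2
    have h3 := abs_add_le (∑ i, b i * (thetaHat p A i - θ i))
      (countVar p 𝓚 (thetaHat p A) - countVar p 𝓚 θ - ∑ i, b i * (thetaHat p A i - θ i))
    rw [add_sub_cancel] at h3
    linarith
  · rw [integral_const_mul, integral_add (integrable_networkLaw _ _) (integrable_networkLaw _ _),
      integral_const_mul]
    calc _ ≤ κW⁻¹ * (26 * c ^ 2 * (B / p) + taylorConst c m *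
          (4 * m * totalWeight p 𝓚 * (momentConst c 2 (4 * m) / √(n * p) ^ 2))) := by
          gcongr
          · exact integral_abs_sum_mul_thetaHat_sub_le h.two_le hp h.p_le_one hc h.p_mul_le_one
              h.θ_nonneg h.θ_le h.sum_θ h.one_le hB0 hbB
          · exact integral_sum_nodeWeight_mul_le h hm 2 (4 * m)
      _ = _ := by
          rw [secondOrderConst, hκW, hB, Real.sq_sqrt (by positivity)]
          field_simp

end Bounds

lemma avgExpectedDegree_pos_and_le {n : ℕ} {p c₀ c : ℝ} {θ : Fin n → ℝ}
    (h : IsChungLuParam p c₀ c θ) :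
    0 < avgExpectedDegree (chungLuMatrix p θ) ∧
      avgExpectedDegree (chungLuMatrix p θ) ≤ c ^ 2 * (n * p) := by
  have hn : (0 : ℝ) < n := by
    have : (2 : ℝ) ≤ n := by exact_mod_cast h.two_le
    linarith
  have hp := h.p_pos
  have hθpos : ∀ v, 0 < θ v := fun v => h.c₀_pos.trans_le (h.le_θ v)
  have h0 : ∀ i j, 0 ≤ chungLuMatrix p θ i j := fun i j => by
    simp only [chungLuMatrix, Matrix.of_apply]
    split_ifs
    exacts [le_rfl, (h.mul_mem i j).1]
  constructor
  · rw [avgExpectedDegree]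
    refine mul_pos (by positivity) ?_
    let i₀ : Fin n := ⟨0, by have := h.two_le; omega⟩
    let i₁ : Fin n := ⟨1, by have := h.two_le; omega⟩
    refine Finset.sum_pos' (fun i _ => Finset.sum_nonneg fun j _ => h0 i j) ⟨i₀, Finset.mem_univ _,
      Finset.sum_pos' (fun j _ => h0 _ j) ⟨i₁, Finset.mem_univ _, ?_⟩⟩
    have : i₀ ≠ i₁ := by simp [i₀, i₁]
    simp only [chungLuMatrix, Matrix.of_apply, if_neg this]
    exact mul_pos (mul_pos hp (hθpos _)) (hθpos _)
  · rw [avgExpectedDegree, inv_mul_le_iff₀ hn]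
    calc ∑ i, ∑ j, chungLuMatrix p θ i j ≤ ∑ i : Fin n, ∑ j : Fin n, p * c ^ 2 := by
          refine Finset.sum_le_sum fun i _ => Finset.sum_le_sum fun j _ => ?_
          simp only [chungLuMatrix, Matrix.of_apply]
          split_ifs
          · positivity
          · rw [mul_assoc, sq]
            exact mul_le_mul_of_nonneg_left (mul_le_mul (h.θ_le _) (h.θ_le _) (h.θ_nonneg _)
              (by linarith [h.one_le_c])) hp.le
      _ = _ := by
          simp only [Finset.sum_const, Finset.card_univ, Fintype.card_fin, nsmul_eq_mul]
          ring

/-- A deviation bound with remainder `O(1 / n)` gives a rate in probability. -/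
lemma isUnifBigOInProb_of_tail_le {Ω ι : ℕ → Type*} [∀ n, MeasurableSpace (Ω n)]
    {μ : ∀ n, Measure (Ω n)} {X : ∀ n, ι n → Ω n → ℝ} {ρ b : ℕ → ℝ} {K K' L : ℝ}
    (hK' : 0 ≤ K') (hL : 0 ≤ L)
    (htail : ∀ᶠ n : ℕ in atTop, ∀ i : ι n, ∀ a : ℝ, 0 < a →
      μ n {ω | a < |X n i ω|} ≤ ENNReal.ofReal (K / n + K' * ρ n / a))
    (hρ : ∀ᶠ n in atTop, 0 < |b n| ∧ ρ n ≤ L * |b n|) : IsUnifBigOInProb μ X b := by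
  intro ε hε
  -- with this `M` the second term of the bound is at most `ε / 2`; the `1` keeps `M` positive
  refine ⟨2 * K' * L / ε + 1, by positivity, ?_⟩
  have hlim : Tendsto (fun n : ℕ => K / (n : ℝ)) atTop (𝓝 0) :=
    tendsto_const_div_atTop_nhds_zero_nat K
  filter_upwards [htail, hρ, hlim.eventually_lt_const (half_pos hε)] with n h1 ⟨h2, h3⟩ h4 i
  have hM : 0 < 2 * K' * L / ε + 1 := by positivity
  refine (h1 i _ (mul_pos hM h2)).trans (ENNReal.ofReal_le_ofReal ?_)
  have h5 : K' * ρ n / ((2 * K' * L / ε + 1) * |b n|) ≤ ε / 2 := by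
    rw [div_le_iff₀ (mul_pos hM h2)]
    calc K' * ρ n ≤ K' * (L * |b n|) := mul_le_mul_of_nonneg_left h3 hK'
      _ = ε / 2 * (2 * K' * L / ε) * |b n| := by field_simp
      _ ≤ ε / 2 * (2 * K' * L / ε + 1) * |b n| := by gcongr; linarith
      _ = _ := by ring
  linarith

lemma eventually_isChungLuParam {p : ℕ → ℝ} (hp0 : Tendsto p atTop (𝓝 0))
    (hnp : Tendsto (fun n : ℕ => (n : ℝ) * p n) atTop atTop)
    {θ : (n : ℕ) → Fin n → ℝ} (hsum : ∀ n : ℕ, ∑ i, θ n i = (n : ℝ))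
    {c₁ c₂ : ℝ} (hc₁ : 0 < c₁) (hθ : ∀ (n : ℕ) (i : Fin n), c₁ < θ n i ∧ θ n i < c₂) :
    ∀ᶠ n in atTop, IsChungLuParam (p n) (min c₁ 1) (max c₂ 1) (θ n) := by
  have h1 : Tendsto (fun n => p n * max c₂ 1 ^ 2) atTop (𝓝 0) := by
    simpa using hp0.mul_const (max c₂ 1 ^ 2)
  filter_upwards [eventually_ge_atTop 2, hnp.eventually_ge_atTop 1,
    h1.eventually_lt_const (by norm_num : (0 : ℝ) < 1 / 4)] with n hn hnp hpc
  exact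
    { two_le := hn
      p_pos := by
        by_contra hcon
        have : (n : ℝ) * p n ≤ 0 := mul_nonpos_of_nonneg_of_nonpos (by positivity) (not_lt.1 hcon)
        linarith
      one_le := hnp
      c₀_pos := lt_min hc₁ one_pos
      c₀_le := min_le_right _ _
      one_le_c := le_max_right _ _
      p_mul_le := hpc.le
      le_θ := fun v => (min_le_left _ _).trans (hθ n v).1.le
      θ_le := fun v => (hθ n v).2.le.trans (le_max_left _ _)
      sum_θ := hsum n }

end NetworkBootstrap

end

/-- Bootstrap approximation of the variance of rooted and global subgraph counts in the
Chung-Lu model `P i j = p θ i θ j` with `1 ≻ p ≻ n⁻¹`, `∑ i, θ i = n` and `c₁ < θ i < c₂`. -/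
theorem mainTheorem4 {W : Type*} [Fintype W] (R : SimpleGraph W) (hR : R.Connected)
    (hv : 3 ≤ Fintype.card W)
    (p : ℕ → ℝ) (hp0 : Tendsto p atTop (𝓝 0))
    (hnp : Tendsto (fun n : ℕ => (n : ℝ) * p n) atTop atTop)
    (θ : (n : ℕ) → Fin n → ℝ) (hsum : ∀ n : ℕ, ∑ i, θ n i = (n : ℝ))
    (c₁ c₂ : ℝ) (hc₁ : 0 < c₁) (hθ : ∀ (n : ℕ) (i : Fin n), c₁ < θ n i ∧ θ n i < c₂) :
    (∀ r : W,
      (∀ᶠ n in atTop, ∀ i : Fin n,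
        0 < NetworkBootstrap.netVar (NetworkBootstrap.chungLuMatrix (p n) (θ n))
          (NetworkBootstrap.rootedCount R r i)) ∧
      NetworkBootstrap.IsUnifBigOInProb
        (fun n => NetworkBootstrap.networkLaw (NetworkBootstrap.chungLuMatrix (p n) (θ n)))
        (fun n (i : Fin n) =>
          NetworkBootstrap.relVarError (p n) (θ n) (NetworkBootstrap.rootedCount R r i))
        (fun n => 1 / √(NetworkBootstrap.avgExpectedDegree
          (NetworkBootstrap.chungLuMatrix (p n) (θ n)))) ∧
      NetworkBootstrap.IsUnifBigOInProb
        (fun n => NetworkBootstrap.networkLaw (NetworkBootstrap.chungLuMatrix (p n) (θ n)))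
        (fun n (i : Fin n) =>
          NetworkBootstrap.relVarError (p n) (θ n) (NetworkBootstrap.rootedCount R r i))
        (fun n => ((n : ℝ) * p n) ^ (-(1 / 2) : ℝ))) ∧
    ((∀ᶠ n in atTop,
        0 < NetworkBootstrap.netVar (NetworkBootstrap.chungLuMatrix (p n) (θ n))
          (NetworkBootstrap.globalCount R)) ∧
      NetworkBootstrap.IsBigOInProb
        (fun n => NetworkBootstrap.networkLaw (NetworkBootstrap.chungLuMatrix (p n) (θ n)))
        (fun n => NetworkBootstrap.relVarError (p n) (θ n) (NetworkBootstrap.globalCount R))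
        (fun n => 1 / NetworkBootstrap.avgExpectedDegree
          (NetworkBootstrap.chungLuMatrix (p n) (θ n))) ∧
      NetworkBootstrap.IsBigOInProb
        (fun n => NetworkBootstrap.networkLaw (NetworkBootstrap.chungLuMatrix (p n) (θ n)))
        (fun n => NetworkBootstrap.relVarError (p n) (θ n) (NetworkBootstrap.globalCount R))
        (fun n => ((n : ℝ) * p n)⁻¹)) := by
  open NetworkBootstrap in
  have hv2 : 2 ≤ Fintype.card W := by omega
  have hm0 := edgeSet_ncard_pos hR hv2
  have hpar := eventually_isChungLuParam hp0 hnp hsum hc₁ hθ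
  have hlarge := eventually_ge_atTop (Fintype.card W)
  set c := max c₂ 1 with hc
  set c₀ := min c₁ 1 with hc₀
  set m := R.edgeSet.ncard with hm
  have hc1 : 1 ≤ c := le_max_right _ _
  have hc₀0 : 0 < c₀ := lt_min hc₁ one_pos
  have hT := taylorConst_nonneg hc1 m
  have hM1 := momentConst_nonneg c 1 (4 * m)
  have hM2 := momentConst_nonneg c 2 (4 * m)
  have hK1 : 0 ≤ firstOrderConst c₀ c m := by unfold firstOrderConst; positivity
  have hK2 : 0 ≤ secondOrderConst c₀ c m := by unfold secondOrderConst; positivity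
  refine ⟨fun r => ?_, ?_⟩
  · have htail : ∀ᶠ n : ℕ in atTop, ∀ i : Fin n, ∀ a : ℝ, 0 < a →
        networkLaw (chungLuMatrix (p n) (θ n))
          {A | a < |relVarError (p n) (θ n) (rootedCount R r i) A|} ≤
        ENNReal.ofReal (16 * momentConst c 4 0 / n +
          firstOrderConst c₀ c m * (1 / √(n * p n)) / a) := by
      filter_upwards [hpar, hlarge] with n h hn i a ha
      exact relVarError_tail_le_first_order h (embeddedCopies_rooted_nonempty R r hn i) hm0
        (fun K hK => card_edgePairs_of_mem_embeddedCopies hK) (rootedCount_eq_sum hR hv2 r i) ha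
    refine ⟨?_, isUnifBigOInProb_of_tail_le (L := c) hK1 (by linarith) htail ?_,
      isUnifBigOInProb_of_tail_le (L := 1) hK1 zero_le_one htail ?_⟩
    · filter_upwards [hpar, hlarge] with n h hn i
      exact netVar_pos h (embeddedCopies_rooted_nonempty R r hn i) hm0
        (fun K hK => card_edgePairs_of_mem_embeddedCopies hK) (rootedCount_eq_sum hR hv2 r i)
    · filter_upwards [hpar] with n h
      obtain ⟨h1, h2⟩ := avgExpectedDegree_pos_and_le h
      have h3 := Real.sqrt_pos.2 h1
      have h4 : (0 : ℝ) < n * p n := by linarith [h.one_le]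
      have h5 := Real.sqrt_pos.2 h4
      rw [abs_of_pos (by positivity)]
      refine ⟨by positivity, ?_⟩
      have h6 := Real.sqrt_le_sqrt h2
      rw [Real.sqrt_mul (by positivity), Real.sqrt_sq (by linarith)] at h6
      rw [mul_one_div, div_le_div_iff₀ h5 h3]
      linarith
    · filter_upwards [hpar] with n h
      have h4 : (0 : ℝ) < n * p n := by linarith [h.one_le]
      have h5 := Real.sqrt_pos.2 h4
      rw [Real.rpow_neg h4.le, ← Real.sqrt_eq_rpow, abs_of_pos (by positivity), one_mul, one_div]
      exact ⟨by positivity, le_rfl⟩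
  · have htail : ∀ᶠ n : ℕ in atTop, ∀ _ : Unit, ∀ a : ℝ, 0 < a →
        networkLaw (chungLuMatrix (p n) (θ n))
          {A | a < |relVarError (p n) (θ n) (globalCount R) A|} ≤
        ENNReal.ofReal (16 * momentConst c 4 0 / n +
          secondOrderConst c₀ c m * (1 / (n * p n)) / a) := by
      filter_upwards [hpar, hlarge] with n h hn _ a ha
      exact relVarError_tail_le_second_order h (embeddedCopies_nonempty R hn) hm0
        (fun K hK => card_edgePairs_of_mem_embeddedCopies hK)
        (fun i j K hK => map_swap_mem_embeddedCopies i j hK) (globalCount_eq_sum hR hv2) ha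
    have hbig : ∀ {b : ℕ → ℝ}, IsUnifBigOInProb (ι := fun _ => Unit)
        (fun n => networkLaw (chungLuMatrix (p n) (θ n)))
        (fun n _ => relVarError (p n) (θ n) (globalCount R)) b →
        IsBigOInProb (fun n => networkLaw (chungLuMatrix (p n) (θ n)))
          (fun n => relVarError (p n) (θ n) (globalCount R)) b := by
      intro b hb ε hε
      obtain ⟨M, hM, h⟩ := hb ε hε
      exact ⟨M, hM, h.mono fun n hn => hn ()⟩
    refine ⟨?_, hbig (isUnifBigOInProb_of_tail_le (L := c ^ 2) hK2 (by positivity) htail ?_),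
      hbig (isUnifBigOInProb_of_tail_le (L := 1) hK2 zero_le_one htail ?_)⟩
    · filter_upwards [hpar, hlarge] with n h hn
      exact netVar_pos h (embeddedCopies_nonempty R hn) hm0
        (fun K hK => card_edgePairs_of_mem_embeddedCopies hK) (globalCount_eq_sum hR hv2)
    · filter_upwards [hpar] with n h
      obtain ⟨h1, h2⟩ := avgExpectedDegree_pos_and_le h
      have h4 : (0 : ℝ) < n * p n := by linarith [h.one_le]
      rw [abs_of_pos (by positivity)]
      refine ⟨by positivity, ?_⟩
      rw [mul_one_div, div_le_div_iff₀ h4 h1]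
      linarith
    · filter_upwards [hpar] with n h
      have h4 : (0 : ℝ) < n * p n := by linarith [h.one_le]
      rw [abs_of_pos (by positivity), one_mul, one_div]
      exact ⟨by positivity, le_rfl⟩
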